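/- Let $p,q\ge 0$ be integers and let $G_{p,q}(\mathbb C)$ be the complex manifold of $p$-dimensional subspaces of $\mathbb C^{p+q}$. For a subset $I\subset\{1,\dots,p+q\}$ with $p$ elements and $Z\in M_{q,p}(\mathbb C)$, let $P_I(Z)\in M_{p+q,p}(\mathbb C)$ be the matrix whose rows with index in $I$ (in increasing order) form the identity matrix and whose other rows form $Z$. The charts $\varphi_I$, whose inverses send $Z=Z_I$ to the column space of $P_I(Z)$, form a holomorphic atlas of $G_{p,q}(\mathbb C)$. Let $\pi$ be the map that sends a matrix $P\in M_{p+q,p}(\mathbb C)$ of rank $p$ to its column space. For a real $(1,1)$-form $\omega=i\sum_{a,b} g_{a\bar b}\,dz_a\wedge d\bar z_b$ with $(g_{a\bar b})$ positive definite, write $|\omega|_I=\det(g_{a\bar b})$ for the determinant of its coefficients in the chart $\varphi_I$. The volume form $dV(\omega)$ is the top-degree form that takes the value $1$ on $(e_1,ie_1,\dots,e_n,ie_n)$ for every basis $(e_a)$ of a tangent space that is unitary for the hermitian form $(g_{a\bar b})$. The Ricci form $\mathcal R(\omega)$ is the form given by $-i\partial\bar\partial\log|\omega|_I$ in each chart $\varphi_I$.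 Then: 0. There is exactly one $2$-form $\omega_{p,q}$ on $G_{p,q}(\mathbb C)$ with $\pi^*\omega_{p,q}=i\partial\bar\partial\log\det({}^tP\,\overline P)$ on the matrices of rank $p$, and it is a Kähler metric form (smooth, real, of type $(1,1)$, positive and closed). There is exactly one top-degree form $\eta$ on $G_{p,q}(\mathbb C)$ which in every chart $\varphi_I$ equals $$\bigl|\det(\mathrm{Id}+{}^tZ_I\,\overline{Z_I})\bigr|^{-(p+q)}\,(i/2)^{pq}\bigwedge_{a}(dz_a\wedge d\bar z_a),$$ where $z_a$ runs over the entries of $Z_I$. 1. $dV(\omega_{p,q})=\eta$. 2. For every $I$, $|\omega_{p,q}|_I=\det(\mathrm{Id}+{}^tZ_I\,\overline{Z_I})^{-(p+q)}$. 3. $\mathcal R(\omega_{p,q})=(p+q)\,\omega_{p,q}$; thus $\omega_{p,q}$ is Kähler–Einstein with factor $p+q$. -/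

import Mathlib

open scoped Matrix Manifold ContDiff

noncomputable section

namespace Grassmann

/-- The complex Grassmann manifold `G_{p,q}(ℂ)`: the set of all `p`-dimensional linear subspaces
of `ℂ^{p+q}`. -/
def Gr (p q : ℕ) : Type :=
  {W : Submodule ℂ (Fin (p + q) → ℂ) // Module.finrank ℂ W = p}

/-- The space `M_{q,p}(ℂ)` in which the charts of `G_{p,q}(ℂ)` take their values, written as the
coordinate space of the entries `z_{ij}` of a matrix. -/
abbrev Model (p q : ℕ) : Type := Fin q × Fin p → ℂ

/-- The matrix with given entries. -/
def mat {m n : Type*} (z : m × n → ℂ) : Matrix m n ℂ := Matrix.of fun i j => z (i, j)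

/-- The entries of a matrix. -/
def entries {m n : Type*} (A : Matrix m n ℂ) : m × n → ℂ := fun a => A a.1 a.2

@[simp] theorem mat_entries {m n : Type*} (A : Matrix m n ℂ) : mat (entries A) = A := rfl

@[simp] theorem entries_mat {m n : Type*} (z : m × n → ℂ) : entries (mat z) = z := rfl

/-- The index set of the charts: subsets of `p` elements of `{1, …, p+q}`. -/
def Idx (p q : ℕ) : Type := {s : Finset (Fin (p + q)) // s.card = p}

variable {p q : ℕ}

/-- The increasing enumeration of `I` (left summand) and of its complement (right summand). -/
def Idx.equiv (I : Idx p q) : Fin p ⊕ Fin q ≃ Fin (p + q) :=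
  finSumEquivOfFinset (s := I.1) I.2 (by simp [Finset.card_compl, I.2])

/-- `m_I(P)`: the rows of `P` with index in `I`. -/
def minor (I : Idx p q) (P : Matrix (Fin (p + q)) (Fin p) ℂ) : Matrix (Fin p) (Fin p) ℂ :=
  P.submatrix (fun i => I.equiv (Sum.inl i)) id

/-- `m_{Iᶜ}(P)`: the rows of `P` with index in the complement of `I`. -/
def minorCompl (I : Idx p q) (P : Matrix (Fin (p + q)) (Fin p) ℂ) : Matrix (Fin q) (Fin p) ℂ :=
  P.submatrix (fun i => I.equiv (Sum.inr i)) id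

/-- The matrix `P_I(Z)` with `m_I(P_I(Z)) = 1` and `m_{Iᶜ}(P_I(Z)) = Z`. -/
def frame (I : Idx p q) (Z : Model p q) : Matrix (Fin (p + q)) (Fin p) ℂ :=
  (Matrix.fromRows 1 (mat Z)).submatrix I.equiv.symm id

theorem ext_rows (I : Idx p q) {P Q : Matrix (Fin (p + q)) (Fin p) ℂ}
    (h₁ : minor I P = minor I Q) (h₂ : minorCompl I P = minorCompl I Q) : P = Q := by
  ext i j
  obtain ⟨k, rfl⟩ := I.equiv.surjective i
  cases k with
  | inl k => exact congrFun (congrFun h₁ k) j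
  | inr k => exact congrFun (congrFun h₂ k) j

@[simp] theorem minor_frame (I : Idx p q) (Z : Model p q) : minor I (frame I Z) = 1 := by
  ext i j; simp [minor, frame]

@[simp] theorem minorCompl_frame (I : Idx p q) (Z : Model p q) :
    minorCompl I (frame I Z) = mat Z := by
  ext i j; simp [minorCompl, frame]

theorem minor_mul (I : Idx p q) (P : Matrix (Fin (p + q)) (Fin p) ℂ)
    (A : Matrix (Fin p) (Fin p) ℂ) : minor I (P * A) = minor I P * A := by
  ext i j; simp [minor, Matrix.mul_apply]

theorem minorCompl_mul (I : Idx p q) (P : Matrix (Fin (p + q)) (Fin p) ℂ)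
    (A : Matrix (Fin p) (Fin p) ℂ) : minorCompl I (P * A) = minorCompl I P * A := by
  ext i j; simp [minorCompl, Matrix.mul_apply]

theorem rank_of_minor (I : Idx p q) {P : Matrix (Fin (p + q)) (Fin p) ℂ}
    (h : (minor I P).det ≠ 0) : P.rank = p := by
  apply le_antisymm (by simpa using P.rank_le_width)
  have h1 : (minor I P).rank = p := by
    simpa using Matrix.rank_of_isUnit (minor I P)
      ((Matrix.isUnit_iff_isUnit_det _).2 (isUnit_iff_ne_zero.2 h))
  calc p = (minor I P).rank := h1.symm
    _ ≤ P.rank := Matrix.rank_submatrix_le _ _ _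

theorem rank_frame (I : Idx p q) (Z : Model p q) : (frame I Z).rank = p :=
  rank_of_minor I (by simp)

theorem range_mul_le (P : Matrix (Fin (p + q)) (Fin p) ℂ) (A : Matrix (Fin p) (Fin p) ℂ) :
    LinearMap.range (P * A).mulVecLin ≤ LinearMap.range P.mulVecLin := by
  rw [Matrix.mulVecLin_mul]; exact LinearMap.range_comp_le_range _ _

theorem range_eq_iff (J : Idx p q) (W : Model p q) (P : Matrix (Fin (p + q)) (Fin p) ℂ) :
    LinearMap.range (frame J W).mulVecLin = LinearMap.range P.mulVecLin ↔
      (minor J P).det ≠ 0 ∧ W = entries (minorCompl J P * (minor J P)⁻¹) := by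
  constructor
  · intro h
    have hcol : ∀ j, ∃ v, P *ᵥ v = (frame J W) *ᵥ (Pi.single j 1) := by
      intro j
      have : (frame J W) *ᵥ (Pi.single j 1) ∈ LinearMap.range P.mulVecLin := by
        rw [← h]; exact ⟨_, rfl⟩
      exact this
    choose v hv using hcol
    have hP : frame J W = P * (Matrix.of v)ᵀ := by
      ext i j
      have := congrFun (hv j) i
      simp only [Matrix.mulVec_single_one] at this
      rw [Matrix.mul_apply]
      exact this.symm
    have h1 : minor J P * (Matrix.of v)ᵀ = 1 := by rw [← minor_mul, ← hP, minor_frame]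
    have h2 : minorCompl J P * (Matrix.of v)ᵀ = mat W := by
      rw [← minorCompl_mul, ← hP, minorCompl_frame]
    refine ⟨(Matrix.isUnit_det_of_right_inverse h1).ne_zero, ?_⟩
    rw [Matrix.inv_eq_right_inv h1, h2, entries_mat]
  · rintro ⟨h, rfl⟩
    have hu : IsUnit (minor J P).det := isUnit_iff_ne_zero.2 h
    have h1 : frame J (entries (minorCompl J P * (minor J P)⁻¹)) = P * (minor J P)⁻¹ := by
      apply ext_rows J
      · rw [minor_frame, minor_mul, Matrix.mul_nonsing_inv _ hu]
      · rw [minorCompl_frame, minorCompl_mul, mat_entries]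
    have h2 : P = frame J (entries (minorCompl J P * (minor J P)⁻¹)) * minor J P := by
      rw [h1, Matrix.mul_assoc, Matrix.nonsing_inv_mul _ hu, Matrix.mul_one]
    apply le_antisymm
    · rw [h1]; exact range_mul_le _ _
    · conv_lhs => rw [h2]
      exact range_mul_le _ _

/-- The inverse of the chart `φ_I`: it sends `Z` to the column space of `P_I(Z)`. -/
def param (I : Idx p q) (Z : Model p q) : Gr p q :=
  ⟨LinearMap.range (frame I Z).mulVecLin, rank_frame I Z⟩

theorem param_eq_iff (I J : Idx p q) (Z W : Model p q) :
    param J W = param I Z ↔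
      (minor J (frame I Z)).det ≠ 0 ∧
        W = entries (minorCompl J (frame I Z) * (minor J (frame I Z))⁻¹) := by
  rw [← range_eq_iff]; exact Subtype.ext_iff

theorem param_injective (I : Idx p q) : Function.Injective (param I) := by
  intro Z W h
  have := ((param_eq_iff I I W Z).1 h).2
  simpa using this

/-- The chart `φ_I`, defined on the set `π(U_I)` of the subspaces that are the column space of a
matrix `P_I(Z)`, with values in `M_{q,p}(ℂ)`. -/
def chart (I : Idx p q) : PartialEquiv (Gr p q) (Model p q) :=
  (Set.InjOn.toPartialEquiv (param I) Set.univ (param_injective I).injOn).symm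

theorem exists_minor {P : Matrix (Fin (p + q)) (Fin p) ℂ} (hP : P.rank = p) :
    ∃ I : Idx p q, (minor I P).det ≠ 0 := by
  obtain ⟨κ, a, ha, hspan, hli⟩ := exists_linearIndependent' ℂ P.row
  have : Finite κ := Finite.of_injective a ha
  have : Fintype κ := Fintype.ofFinite κ
  have hcard : Fintype.card κ = p := by
    rw [← hP, Matrix.rank_eq_finrank_span_row, ← hspan, finrank_span_eq_card hli]
  let I : Idx p q := ⟨Finset.univ.map ⟨a, ha⟩, by simp [hcard]⟩
  refine ⟨I, ?_⟩
  have hmem : ∀ i : Fin p, ∃ k, a k = I.equiv (Sum.inl i) := by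
    intro i
    have : I.equiv (Sum.inl i) ∈ I.1 := by
      simp [Idx.equiv, finSumEquivOfFinset_inl]
    simpa [I] using this
  choose k hk using hmem
  have hkinj : Function.Injective k := by
    intro i j hij
    have : I.equiv (Sum.inl i) = I.equiv (Sum.inl j) := by rw [← hk, ← hk, hij]
    simpa using this
  have hli' : LinearIndependent ℂ (minor I P).row := by
    have := hli.comp k hkinj
    have h : (minor I P).row = (P.row ∘ a) ∘ k := by
      funext i
      simp only [Function.comp_apply, hk]
      rfl
    rw [h]; exact this
  exact (Matrix.isUnit_iff_isUnit_det _).1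
    (Matrix.linearIndependent_rows_iff_isUnit.1 hli') |>.ne_zero

theorem exists_param (x : Gr p q) : ∃ I : Idx p q, x ∈ Set.range (param I) := by
  obtain ⟨W, hW⟩ := x
  let b := Module.finBasisOfFinrankEq ℂ W hW
  let P : Matrix (Fin (p + q)) (Fin p) ℂ := Matrix.of fun i j => (b j : Fin (p + q) → ℂ) i
  have hr : LinearMap.range P.mulVecLin = W := by
    rw [Matrix.range_mulVecLin]
    have : Set.range P.col = W.subtype '' Set.range b := by
      rw [← Set.range_comp]; rfl
    rw [this, ← Submodule.map_span, b.span_eq, Submodule.map_top, Submodule.range_subtype]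
  have hP : P.rank = p := by rw [Matrix.rank, hr, hW]
  obtain ⟨I, hI⟩ := exists_minor hP
  refine ⟨I, entries (minorCompl I P * (minor I P)⁻¹), ?_⟩
  apply Subtype.ext
  exact ((range_eq_iff I _ P).2 ⟨hI, rfl⟩).trans hr

/-- The change of charts `φ_J ∘ φ_I⁻¹` in coordinates. -/
def transition (I J : Idx p q) (Z : Model p q) : Model p q :=
  entries (minorCompl J (frame I Z) * (minor J (frame I Z))⁻¹)

@[simp] theorem chart_symm_apply (I : Idx p q) (Z : Model p q) : (chart I).symm Z = param I Z := rfl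

theorem chart_source (I : Idx p q) : (chart I).source = Set.range (param I) := by
  simp [chart, Set.image_univ]

@[simp] theorem chart_target (I : Idx p q) : (chart I).target = Set.univ := by
  simp [chart]

theorem chart_param (I : Idx p q) (Z : Model p q) : chart I (param I Z) = Z :=
  (chart I).right_inv (x := Z) (by simp)

theorem mem_source_iff (I J : Idx p q) (Z : Model p q) :
    param I Z ∈ (chart J).source ↔ (minor J (frame I Z)).det ≠ 0 := by
  rw [chart_source]
  constructor
  · rintro ⟨W, hW⟩; exact ((param_eq_iff I J Z W).1 hW).1
  · intro h; exact ⟨_, (param_eq_iff I J Z _).2 ⟨h, rfl⟩⟩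

theorem chart_param_eq (I J : Idx p q) (Z : Model p q) (h : (minor J (frame I Z)).det ≠ 0) :
    chart J (param I Z) = transition I J Z := by
  rw [← (param_eq_iff I J Z (transition I J Z)).2 ⟨h, rfl⟩, chart_param]

theorem trans_source (I J : Idx p q) :
    ((chart I).symm.trans (chart J)).source = {Z | (minor J (frame I Z)).det ≠ 0} := by
  ext Z
  simp only [PartialEquiv.trans_source, PartialEquiv.symm_source, chart_target, Set.univ_inter,
    Set.mem_preimage, chart_symm_apply, Set.mem_ofPred_eq]
  exact mem_source_iff I J Z

theorem contDiffOn_det {E n : Type*} [NormedAddCommGroup E] [NormedSpace ℂ E] [Fintype n]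
    [DecidableEq n] {f : E → Matrix n n ℂ} {s : Set E}
    (hf : ∀ i j, ContDiffOn ℂ ω (fun x => f x i j) s) :
    ContDiffOn ℂ ω (fun x => (f x).det) s := by
  simp only [Matrix.det_apply, zsmul_eq_mul, Units.smul_def]
  exact ContDiffOn.sum fun σ _ => contDiffOn_const.mul (contDiffOn_prod fun i _ => hf _ _)

theorem contDiff_frame (I : Idx p q) (i : Fin (p + q)) (j : Fin p) :
    ContDiff ℂ ω (fun Z : Model p q => frame I Z i j) := by
  obtain ⟨k, rfl⟩ := I.equiv.surjective i
  cases k with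
  | inl k => simpa [frame] using contDiff_const
  | inr k =>
    simp only [frame, Matrix.submatrix_apply, Equiv.symm_apply_apply, Matrix.fromRows_apply_inr]
    exact contDiff_apply ℂ ℂ (k, j)

theorem contDiffOn_transition (I J : Idx p q) :
    ContDiffOn ℂ ω (transition I J) {Z | (minor J (frame I Z)).det ≠ 0} := by
  rw [contDiffOn_pi]
  rintro ⟨i, j⟩
  have hm : ∀ a b, ContDiffOn ℂ ω (fun Z : Model p q => minor J (frame I Z) a b)
      {Z | (minor J (frame I Z)).det ≠ 0} := fun a b => (contDiff_frame I _ _).contDiffOn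
  simp only [transition, entries, Matrix.mul_apply, Matrix.inv_def, Matrix.smul_apply, smul_eq_mul,
    Ring.inverse_eq_inv']
  refine ContDiffOn.sum fun k _ => ?_
  refine (contDiff_frame I _ _).contDiffOn.mul (ContDiffOn.mul ?_ ?_)
  · exact (contDiffOn_det hm).inv fun Z hZ => hZ
  · simp only [Matrix.adjugate_apply]
    refine contDiffOn_det fun a b => ?_
    by_cases h : a = j
    · subst h; simp only [Matrix.updateRow_self]; exact contDiffOn_const
    · simp only [Matrix.updateRow_ne h]; exact hm a b

theorem isOpen_minor (I J : Idx p q) : IsOpen {Z : Model p q | (minor J (frame I Z)).det ≠ 0} := by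
  have : Continuous fun Z : Model p q => (minor J (frame I Z)).det := by
    refine Continuous.matrix_det ?_
    exact continuous_matrix fun a b => (contDiff_frame I _ _).continuous
  exact isOpen_compl_singleton.preimage this

/-- The atlas `(φ_I)_I` of the Grassmann manifold. -/
def core (p q : ℕ) : ChartedSpaceCore (Model p q) (Gr p q) where
  atlas := Set.range chart
  chartAt x := chart (exists_param x).choose
  mem_chart_source x := by rw [chart_source]; exact (exists_param x).choose_spec
  chart_mem_atlas x := ⟨_, rfl⟩
  open_source := by
    rintro _ _ ⟨I, rfl⟩ ⟨J, rfl⟩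
    rw [trans_source]; exact isOpen_minor I J
  continuousOn_toFun := by
    rintro _ _ ⟨I, rfl⟩ ⟨J, rfl⟩
    rw [trans_source]
    exact (contDiffOn_transition I J).continuousOn.congr fun Z hZ => chart_param_eq I J Z hZ

/-- The topology for which the charts `φ_I` are homeomorphisms between open sets. -/
instance : TopologicalSpace (Gr p q) := (core p q).toTopologicalSpace

instance : ChartedSpace (Model p q) (Gr p q) := (core p q).toChartedSpace

/-- `G_{p,q}(ℂ)` is a complex manifold. -/
instance : IsManifold 𝓘(ℂ, Model p q) ω (Gr p q) := by
  apply isManifold_of_contDiffOn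
  intro e e' he he'
  obtain ⟨_, ⟨I, rfl⟩, rfl⟩ : ∃ f, ∃ h : f ∈ (core p q).atlas,
      e = (core p q).openPartialHomeomorph f h := by
    simpa [atlas, ChartedSpace.atlas, ChartedSpaceCore.toChartedSpace] using he
  obtain ⟨_, ⟨J, rfl⟩, rfl⟩ : ∃ f, ∃ h : f ∈ (core p q).atlas,
      e' = (core p q).openPartialHomeomorph f h := by
    simpa [atlas, ChartedSpace.atlas, ChartedSpaceCore.toChartedSpace] using he'
  simp only [modelWithCornersSelf_coe, modelWithCornersSelf_coe_symm, Function.comp_id,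
    Function.id_comp, Set.preimage_id, Set.range_id, Set.inter_univ]
  have hs : ((chart I).symm.trans (chart J)).source = _ := trans_source I J
  refine ContDiffOn.congr (f := transition I J) ?_ ?_
  · exact (contDiffOn_transition I J).mono hs.subset
  · intro Z hZ
    exact chart_param_eq I J Z (hs.subset hZ)

theorem nonempty_idx : Nonempty (Idx p q) := by
  obtain ⟨s, -, hs⟩ := Finset.exists_subset_card_eq
    (s := (Finset.univ : Finset (Fin (p + q)))) (n := p) (by simp)
  exact ⟨⟨s, hs⟩⟩

instance : Nonempty (Gr p q) := ⟨param (nonempty_idx (p := p) (q := q)).some 0⟩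

open Classical in
/-- The projection `π` from the open set `M_{p,q}` of the matrices of rank `p` in
`M_{p+q,p}(ℂ)` onto `G_{p,q}(ℂ)`, sending a matrix to its column space. (The value at a matrix of
smaller rank is irrelevant.) -/
def proj (P : Fin (p + q) × Fin p → ℂ) : Gr p q :=
  if h : (mat P).rank = p then ⟨LinearMap.range (mat P).mulVecLin, h⟩ else Classical.arbitrary _

/-! ### Forms on a complex coordinate space `ℂ^ι` -/

section Coordinates

variable {ι : Type*} [Fintype ι] [DecidableEq ι]

theorem matrix_update {V κ : Type*} [AddCommGroup V] [Module ℝ V] [TopologicalSpace V]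
    [DecidableEq κ] (θ : κ → V →L[ℝ] ℂ) (v : κ → V) (l : κ) (z : V) :
    (Matrix.of fun l' k => θ k (Function.update v l z l')) =
      (Matrix.of fun l' k => θ k (v l')).updateRow l (fun k => θ k z) := by
  ext a b
  by_cases hab : a = l
  · subst hab; simp
  · simp [hab]

/-- The wedge product of a family of complex-valued real-linear forms:
`(⋀ θ_k)(v) = det (θ_k (v_l))`. -/
def wedge {V κ : Type*} [AddCommGroup V] [Module ℝ V] [TopologicalSpace V] [Fintype κ]
    [hκ : DecidableEq κ] (θ : κ → V →L[ℝ] ℂ) : V [⋀^κ]→L[ℝ] ℂ where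
  toFun v := (Matrix.of fun l k => θ k (v l)).det
  map_update_add' {inst} v l x y := by
    obtain rfl : inst = hκ := Subsingleton.elim _ _
    simp only [matrix_update, map_add]
    exact Matrix.det_updateRow_add _ _ _ _
  map_update_smul' {inst} v l c x := by
    obtain rfl : inst = hκ := Subsingleton.elim _ _
    simp only [matrix_update, map_smul, Complex.real_smul]
    exact Matrix.det_updateRow_smul _ _ _ _
  map_eq_zero_of_eq' v i j hv hij := Matrix.det_zero_of_row_eq hij (by ext k; simp [hv])
  cont := by
    refine Continuous.matrix_det (continuous_matrix fun l k => ?_)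
    exact (θ k).continuous.comp (continuous_apply l)

/-- The 1-form `dz_a`. -/
def dz (a : ι) : (ι → ℂ) →L[ℝ] ℂ := ContinuousLinearMap.proj a

/-- The 1-form `dz̄_a`. -/
def dzbar (a : ι) : (ι → ℂ) →L[ℝ] ℂ := Complex.conjCLE.toContinuousLinearMap.comp (dz a)

/-- The derivative `∂f/∂z_a = (∂f/∂x_a - i ∂f/∂y_a)/2`. -/
def del (a : ι) (f : (ι → ℂ) → ℂ) (z : ι → ℂ) : ℂ :=
  (fderiv ℝ f z (Pi.single a 1) - Complex.I * fderiv ℝ f z (Pi.single a Complex.I)) / 2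

/-- The derivative `∂f/∂z̄_a = (∂f/∂x_a + i ∂f/∂y_a)/2`. -/
def delbar (a : ι) (f : (ι → ℂ) → ℂ) (z : ι → ℂ) : ℂ :=
  (fderiv ℝ f z (Pi.single a 1) + Complex.I * fderiv ℝ f z (Pi.single a Complex.I)) / 2

/-- The form `i∂∂̄f = i ∑_{a,b} (∂²f/∂z_a∂z̄_b) dz_a ∧ dz̄_b`. -/
def iddbar (f : (ι → ℂ) → ℂ) (z : ι → ℂ) : (ι → ℂ) [⋀^Fin 2]→L[ℝ] ℂ :=
  Complex.I • ∑ a, ∑ b, del a (delbar b f) z • wedge ![dz a, dzbar b]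

/-- The form `(i/2)^n ⋀_a (dz_a ∧ dz̄_a)`, with `n` the number of coordinates. A simultaneous
permutation of forms and arguments does not change a determinant, so no order of the coordinates
has to be chosen. -/
def stdVol (ι : Type*) [Fintype ι] [DecidableEq ι] : (ι → ℂ) [⋀^(ι × Fin 2)]→L[ℝ] ℂ :=
  (Complex.I / 2) ^ Fintype.card ι •
    wedge fun c : ι × Fin 2 => if c.2 = 0 then dz c.1 else dzbar c.1

end Coordinates

/-! ### Forms on the Grassmann manifold -/

/-- Complex-valued differential forms on `G_{p,q}(ℂ)`, seen as a real manifold, with arguments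
indexed by `κ`. -/
abbrev Form (p q : ℕ) (κ : Type) : Type :=
  ∀ x : Gr p q, TangentSpace 𝓘(ℂ, Model p q) x [⋀^κ]→L[ℝ] ℂ

/-- The pullback of a form by a map into `G_{p,q}(ℂ)`. -/
def pullback {E : Type*} [NormedAddCommGroup E] [NormedSpace ℂ E] {κ : Type} (F : E → Gr p q)
    (θ : Form p q κ) (z : E) : E [⋀^κ]→L[ℝ] ℂ :=
  (θ (F z)).compContinuousLinearMap
    ((mfderiv 𝓘(ℂ, E) 𝓘(ℂ, Model p q) F z).restrictScalars ℝ)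

/-- The expression of a form in the chart `φ_I`. -/
def inChart {κ : Type} (I : Idx p q) (θ : Form p q κ) : Model p q → Model p q [⋀^κ]→L[ℝ] ℂ :=
  pullback (param I) θ

/-- The hermitian form `g` with `ω = i ∑ g_{ab} dz_a ∧ dz̄_b`, for a form `ω` of type `(1,1)`. -/
def herm {V : Type*} [AddCommGroup V] [Module ℂ V] [TopologicalSpace V]
    (θ : V [⋀^Fin 2]→L[ℝ] ℂ) (v w : V) : ℂ :=
  (θ ![v, Complex.I • w] - Complex.I * θ ![v, w]) / 2

/-- The coefficients `g_{ab}` in the chart `φ_I` of `ω = i ∑ g_{ab} dz_a ∧ dz̄_b`. -/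
def coeff (I : Idx p q) (θ : Form p q (Fin 2)) (Z : Model p q) :
    Matrix (Fin q × Fin p) (Fin q × Fin p) ℂ :=
  Matrix.of fun a b => herm (inChart I θ Z) (Pi.single a 1) (Pi.single b 1)

/-- `ω` is the form of a Kähler metric: smooth, real, of type `(1,1)`, positive and closed. -/
structure IsKahler (θ : Form p q (Fin 2)) : Prop where
  smooth : ∀ I, ContDiff ℝ ∞ (inChart I θ)
  real : ∀ x v, (θ x v).im = 0
  type : ∀ x v w, θ x ![Complex.I • v, Complex.I • w] = θ x ![v, w]
  pos : ∀ x v, v ≠ 0 → 0 < (θ x ![v, Complex.I • v]).re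
  closed : ∀ I Z, extDeriv (inChart I θ) Z = 0

/-- `R` is the Ricci form of the metric form `ω = i ∑ g_{ab} dz_a ∧ dz̄_b`: in every chart,
`R = -i∂∂̄ log det (g_{ab})`. -/
def IsRicciForm (θ R : Form p q (Fin 2)) : Prop :=
  ∀ I Z, inChart I R Z = -iddbar (fun Y => (Real.log ((coeff I θ Y).det).re : ℂ)) Z

/-- `ω` is Kähler–Einstein with factor `k`. -/
def IsKahlerEinstein (θ : Form p q (Fin 2)) (k : ℝ) : Prop :=
  IsKahler θ ∧ IsRicciForm θ (fun x => k • θ x)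

/-- `μ` is the volume form of the metric `ω = i ∑ g_{ab} dz_a ∧ dz̄_b`: it takes the value `1` on
`(e_1, i e_1, …, e_n, i e_n)` for every basis `(e_a)` of a tangent space which is unitary for the
hermitian form `g`. -/
def IsVolumeForm (θ : Form p q (Fin 2)) (μ : Form p q ((Fin q × Fin p) × Fin 2)) : Prop :=
  ∀ (x : Gr p q) (e : Fin q × Fin p → TangentSpace 𝓘(ℂ, Model p q) x),
    (∀ a b, herm (θ x) (e a) (e b) = if a = b then 1 else 0) →
      μ x (fun c => if c.2 = 0 then e c.1 else Complex.I • e c.1) = 1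

/-- `det (ᵗP P̄)`. -/
def gram {m n : Type*} [Fintype m] [Fintype n] [DecidableEq n] (P : Matrix m n ℂ) : ℂ :=
  (Pᵀ * P.map (starRingEnd ℂ)).det

/-- `det (1 + ᵗZ Z̄)`. -/
def chartGram (Z : Model p q) : ℂ := (1 + (mat Z)ᵀ * (mat Z).map (starRingEnd ℂ)).det

/-- `ω` is the form on `G_{p,q}(ℂ)` onto which `i∂∂̄ log det (ᵗP P̄)` projects, that is
`π^* ω = i∂∂̄ log det (ᵗP P̄)` on the matrices of rank `p`. -/
def IsGrassmannMetric (θ : Form p q (Fin 2)) : Prop :=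
  ∀ P : Fin (p + q) × Fin p → ℂ, (mat P).rank = p →
    pullback proj θ P = iddbar (fun Q => (Real.log (gram (mat Q)).re : ℂ)) P

/-- `η` is the form with the expression `|det (1 + ᵗZ Z̄)|^{-(p+q)} (i/2)^{pq} ⋀ (dz_a ∧ dz̄_a)`
in every chart `φ_I`. -/
def IsEta (μ : Form p q ((Fin q × Fin p) × Fin 2)) : Prop :=
  ∀ I Z, inChart I μ Z = ‖chartGram Z‖ ^ (-((p : ℤ) + q)) • stdVol (Fin q × Fin p)

end Grassmann

end

/-! In a chart everything comes from the potential `log det (1 + ᵗZ Z̄)`. The key reformulation is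
`i∂∂̄f = d(-(1/2) df ∘ i)` (`iddbar_eq_extDeriv`): it makes `i∂∂̄` commute with holomorphic pullback
(`extDeriv_twist_comp`), makes it closed, and makes it vanish on real parts of holomorphic
functions, hence on `log |g|²` (`extDeriv_twist_log_normSq`).

A matrix of rank `p` factors near a point as `P = P_J(Z) m_J(P)`, so `log det (ᵗP P̄)` is the
potential at `Z` plus `log |det m_J(P)|²`. The last term is pluriharmonic, so `i∂∂̄ log det (ᵗP P̄)`
descends along `π` (`iddbar_logGram`). The descended form is unique because the parametrizations
factor through `π` (`inChart_eq_pullback_proj`).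

Two differentiations give the Levi matrix as the Kronecker product of `(1 + Z̄ ᵗZ)⁻¹`, of size `q`,
and the transpose of `(1 + ᵗZ Z̄)⁻¹`, of size `p` (`levi_potential`). It is positive definite, and
since both inverted matrices have the same determinant, its determinant is `det (1 + ᵗZ Z̄)` to the
power `-(p+q)`. The Einstein equation follows by taking logarithms. The volume statement and the
chart independence of `η` both hold because `det (g_{ab})` and the standard volume form acquire the
same factor `|det|²` under a complex-linear map. -/

noncomputable section

namespace Grassmann

/-! ### Derivatives of determinants and inverses -/

section MatrixCalculus

variable {n : Type*} [Fintype n] [DecidableEq n]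

/-- Jacobi's formula for the derivative of a determinant. -/
theorem hasDerivAt_det {A : ℝ → Matrix n n ℂ} {A' : Matrix n n ℂ} {t : ℝ}
    (h : ∀ i j, HasDerivAt (fun s => A s i j) (A' i j) t) :
    HasDerivAt (fun s => (A s).det) ((A t).adjugate * A').trace t := by
  -- By Cramer, the `i`-th diagonal entry of `adj(A) A'` is the determinant of `A` with column `i`
  -- replaced by that of `A'`. Its Leibniz expansion, summed over `i`, is the product rule applied
  -- to that of `det A`.
  have key : ((A t).adjugate * A').trace
      = ∑ σ : Equiv.Perm n, ((Equiv.Perm.sign σ : ℤ) : ℂ) *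
        ∑ i, (∏ j ∈ Finset.univ.erase i, A t (σ j) j) • A' (σ i) i := by
    have h1 : ∀ i, ((A t).updateCol i (fun k => A' k i)).det = ((A t).adjugate * A') i i := by
      intro i
      rw [← Matrix.cramer_apply, Matrix.cramer_eq_adjugate_mulVec]
      rfl
    simp only [Matrix.trace, Matrix.diag_apply, ← h1, Matrix.det_apply', Finset.mul_sum]
    rw [Finset.sum_comm]
    refine Finset.sum_congr rfl fun σ _ => Finset.sum_congr rfl fun i _ => ?_
    rw [← Finset.mul_prod_erase _ _ (Finset.mem_univ i), Matrix.updateCol_self, smul_eq_mul,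
      mul_comm (A' _ _)]
    congr 2
    refine Finset.prod_congr rfl fun j hj => ?_
    rw [Matrix.updateCol_ne (Finset.ne_of_mem_erase hj)]
  rw [key]
  simp only [Matrix.det_apply']
  exact HasDerivAt.fun_sum fun σ _ =>
    (HasDerivAt.fun_finsetProd fun i _ => h (σ i) i).const_mul _

/-- Cramer's rule gives differentiability of the entries with some derivative; differentiating `A
A⁻¹ = 1` then identifies it. -/
theorem hasDerivAt_inv_entry {A : ℝ → Matrix n n ℂ} {A' : Matrix n n ℂ} {t : ℝ}
    (h : ∀ i j, HasDerivAt (fun s => A s i j) (A' i j) t) (hA : (A t).det ≠ 0) (i j : n) :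
    HasDerivAt (fun s => (A s)⁻¹ i j) ((-((A t)⁻¹ * A' * (A t)⁻¹)) i j) t := by
  have hdet := hasDerivAt_det h
  have hadj : ∀ k l, ∃ d, HasDerivAt (fun s => (A s)⁻¹ k l) d t := by
    intro k l
    have h1 : ∀ a b, HasDerivAt (fun s => ((A s).updateRow l (Pi.single k 1)) a b)
        ((A'.updateRow l 0) a b) t := by
      intro a b
      by_cases hab : a = l
      · subst hab; simp only [Matrix.updateRow_self]; exact hasDerivAt_const _ _
      · simp only [Matrix.updateRow_ne hab]; exact h a b
    have h2 := (hdet.inv hA).mul (hasDerivAt_det h1)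
    refine ⟨_, h2.congr_of_eventuallyEq (Filter.Eventually.of_forall fun s => ?_)⟩
    simp [Matrix.inv_def, Matrix.adjugate_apply, Ring.inverse_eq_inv']
  choose B' hB' using hadj
  let B'm : Matrix n n ℂ := Matrix.of B'
  have hprod : A' * (A t)⁻¹ + A t * B'm = 0 := by
    ext a b
    have h1 : HasDerivAt (fun s => (A s * (A s)⁻¹) a b) ((A' * (A t)⁻¹ + A t * B'm) a b) t := by
      simp only [Matrix.mul_apply, Matrix.add_apply, ← Finset.sum_add_distrib]
      exact HasDerivAt.fun_sum fun k _ => (h a k).mul (hB' k b)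
    have h2 : (fun s => (A s * (A s)⁻¹) a b) =ᶠ[nhds t] fun _ => (1 : Matrix n n ℂ) a b := by
      filter_upwards [hdet.continuousAt.eventually_ne hA] with s hs
      rw [Matrix.mul_nonsing_inv _ (isUnit_iff_ne_zero.2 hs)]
    exact h1.unique ((hasDerivAt_const t _).congr_of_eventuallyEq h2)
  have hu : IsUnit (A t).det := isUnit_iff_ne_zero.2 hA
  have : B'm = -((A t)⁻¹ * A' * (A t)⁻¹) := by
    have h3 : (A t)⁻¹ * (A' * (A t)⁻¹ + A t * B'm) = 0 := by rw [hprod, Matrix.mul_zero]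
    rw [Matrix.mul_add, ← Matrix.mul_assoc, ← Matrix.mul_assoc, Matrix.nonsing_inv_mul _ hu,
      Matrix.one_mul] at h3
    exact (neg_eq_of_add_eq_zero_right h3).symm
  rw [← this]
  exact hB' i j

end MatrixCalculus

/-! ### The operator `i∂∂̄` as an exterior derivative -/

section Potential

/-- Multiplication by `i` as a real-linear map. -/
def mulI (E : Type*) [NormedAddCommGroup E] [NormedSpace ℂ E] : E →L[ℝ] E :=
  (Complex.I • ContinuousLinearMap.id ℂ E).restrictScalars ℝ

variable {E E' : Type*} [NormedAddCommGroup E] [NormedSpace ℂ E]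
  [NormedAddCommGroup E'] [NormedSpace ℂ E']

@[simp] theorem mulI_apply (v : E) : mulI E v = Complex.I • v := rfl

/-- The 1-form `-(1/2) df ∘ i`, whose exterior derivative is `i∂∂̄f`. -/
def twist (f : E → ℂ) (z : E) : E [⋀^Fin 1]→L[ℝ] ℂ :=
  ContinuousAlternatingMap.ofSubsingletonLIE (𝕜 := ℝ) (0 : Fin 1)
    ((-(1 / 2) : ℝ) • (fderiv ℝ f z).comp (mulI E))

theorem twist_apply (f : E → ℂ) (z : E) (v : Fin 1 → E) :
    twist f z v = (-(1 / 2) : ℝ) • fderiv ℝ f z (Complex.I • v 0) := rfl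

theorem contDiffAt_twist {f : E → ℂ} {z : E} {m n : WithTop ℕ∞} (hf : ContDiffAt ℝ n f z)
    (h : m + 1 ≤ n) : ContDiffAt ℝ m (twist f) z := by
  have h1 : ContDiffAt ℝ m (fun y => (-(1 / 2) : ℝ) • (fderiv ℝ f y).comp (mulI E)) z :=
    ((hf.fderiv_right h).clm_comp contDiffAt_const).const_smul _
  exact (ContinuousAlternatingMap.ofSubsingletonLIE (𝕜 := ℝ) (E := E) (F := ℂ)
    (0 : Fin 1)).toContinuousLinearEquiv.contDiff.contDiffAt.comp z h1

/-- The exterior derivative of a 1-form antisymmetrizes its derivative; symmetry of the second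
derivative of `f` moves `i` to the first slot in one of the two terms. -/
theorem extDeriv_twist {f : E → ℂ} {z : E} (hf : ContDiffAt ℝ 2 f z) (v : Fin 2 → E) :
    extDeriv (twist f) z v =
      (1 / 2 : ℝ) • (fderiv ℝ (fderiv ℝ f) z (Complex.I • v 0) (v 1)
        - fderiv ℝ (fderiv ℝ f) z (v 0) (Complex.I • v 1)) := by
  have hd : DifferentiableAt ℝ (fderiv ℝ f) z :=
    (hf.fderiv_right (m := 1) (by norm_num)).differentiableAt one_ne_zero
  have hs : IsSymmSndFDerivAt ℝ f z := hf.isSymmSndFDerivAt (by simp)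
  have h1 : ∀ w : E, fderiv ℝ (fun y => (-(1 / 2) : ℝ) • fderiv ℝ f y w) z
      = (-(1 / 2) : ℝ) • (fderiv ℝ (fderiv ℝ f) z).flip w := by
    intro w
    ext u
    rw [fderiv_fun_const_smul (hd.clm_apply (differentiableAt_const w)),
      fderiv_clm_apply hd (differentiableAt_const w)]
    simp
  rw [extDeriv_apply ((contDiffAt_twist (m := 1) hf (by norm_num)).differentiableAt one_ne_zero)]
  simp only [twist_apply, h1]
  simp [Fin.removeNth, hs.eq (v 1) (Complex.I • v 0)]
  ring

/-- The derivative of a holomorphic `F` commutes with `i`, so `twist (f ∘ F)` is the pullback of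
`twist f` near `z`, and `d` commutes with pullback. -/
theorem extDeriv_twist_comp {f : E' → ℂ} {F : E → E'} {z : E} (hf : ContDiffAt ℝ 2 f (F z))
    (hF : ContDiffAt ℂ 2 F z) :
    extDeriv (twist (f ∘ F)) z =
      (extDeriv (twist f) (F z)).compContinuousLinearMap ((fderiv ℂ F z).restrictScalars ℝ) := by
  have hFd : ∀ᶠ y in nhds z, DifferentiableAt ℂ F y := by
    filter_upwards [hF.eventually (by simp)] with y hy using hy.differentiableAt two_ne_zero
  have hfd : ∀ᶠ y in nhds z, DifferentiableAt ℝ f (F y) := by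
    have : ∀ᶠ y in nhds (F z), DifferentiableAt ℝ f y := by
      filter_upwards [hf.eventually (by simp)] with y hy using hy.differentiableAt two_ne_zero
    exact hF.continuousAt.eventually this
  have h1 : twist (f ∘ F) =ᶠ[nhds z]
      fun y => (twist f (F y)).compContinuousLinearMap (fderiv ℝ F y) := by
    filter_upwards [hFd, hfd] with y hy hy'
    ext v
    have hr := hy.fderiv_restrictScalars ℝ
    rw [ContinuousAlternatingMap.compContinuousLinearMap_apply, twist_apply, twist_apply,
      fderiv_comp y hy' (hy.restrictScalars ℝ), hr]
    simp
  rw [h1.extDeriv_eq, extDeriv_pullback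
    ((contDiffAt_twist (m := 1) hf (by norm_num)).differentiableAt one_ne_zero)
    (hF.restrict_scalars ℝ) (by simp),
    (hF.differentiableAt two_ne_zero).fderiv_restrictScalars ℝ]

/-- By naturality it suffices to treat the function `Re` on `ℂ`, which is real-linear and so has
zero second derivative. -/
theorem extDeriv_twist_re {h : E → ℂ} {z : E} (hh : ContDiffAt ℂ 2 h z) :
    extDeriv (twist fun y => ((h y).re : ℂ)) z = 0 := by
  let R : ℂ →L[ℝ] ℂ := Complex.ofRealCLM.comp Complex.reCLM
  have hR : ContDiffAt ℝ 2 (fun w : ℂ => (w.re : ℂ)) (h z) := R.contDiff.contDiffAt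
  have h1 := extDeriv_twist_comp hR hh
  have h2 : extDeriv (twist fun w : ℂ => (w.re : ℂ)) (h z) = 0 := by
    ext v
    have h3 : fderiv ℝ (fun w : ℂ => (w.re : ℂ)) = fun _ => R := funext fun w => R.fderiv
    rw [extDeriv_twist hR, h3]
    simp
  rw [h2] at h1
  refine h1.trans ?_
  ext v; simp

/-- `log |g|²` is pluriharmonic for holomorphic `g` without zeros. -/
theorem extDeriv_twist_log_normSq {g : E → ℂ} {z : E} (hg : ContDiffAt ℂ 2 g z) (h0 : g z ≠ 0) :
    extDeriv (twist fun y => (Real.log (Complex.normSq (g y)) : ℂ)) z = 0 := by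
  -- Multiplying by `c` brings the value at `z` to `|g z|² > 0`, away from the cut of the logarithm.
  -- Hence `log |g|²` is locally the real part of the holomorphic function `2 log (c g) - 2 log
  -- |c|`.
  obtain ⟨c, hc⟩ : ∃ c, c = starRingEnd ℂ (g z) := ⟨_, rfl⟩
  have hc0 : c ≠ 0 := by simpa [hc] using h0
  have hpos : c * g z ∈ Complex.slitPlane := by
    left
    rw [hc, ← Complex.normSq_eq_conj_mul_self, Complex.ofReal_re]
    exact Complex.normSq_pos.2 h0
  have hlog : ContDiffAt ℂ 2 (fun y => Complex.log (c * g y)) z :=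
    ContDiffAt.comp (g := Complex.log) (f := fun y => c * g y) z (Complex.contDiffAt_log hpos)
      (contDiffAt_const.mul hg)
  have hcg : ContDiffAt ℂ 2 (fun y => 2 * Complex.log (c * g y) - 2 * Real.log ‖c‖) z :=
    ContDiffAt.sub (contDiffAt_const.mul hlog) contDiffAt_const
  rw [← extDeriv_twist_re hcg]
  apply Filter.EventuallyEq.extDeriv_eq
  have h1 : (fun y => (Real.log (Complex.normSq (g y)) : ℂ)) =ᶠ[nhds z]
      fun y => (((2 * Complex.log (c * g y) - 2 * Real.log ‖c‖).re : ℝ) : ℂ) := by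
    filter_upwards [hg.continuousAt.eventually_ne h0] with y hy
    congr 1
    have : (2 * Complex.log (c * g y) - 2 * Real.log ‖c‖).re
        = 2 * (Complex.log (c * g y)).re - 2 * Real.log ‖c‖ := by simp
    rw [this, Complex.log_re, norm_mul, Real.log_mul (norm_ne_zero_iff.2 hc0)
      (norm_ne_zero_iff.2 hy), Complex.normSq_eq_norm_sq, Real.log_pow]
    push_cast; ring
  filter_upwards [h1.eventuallyEq_nhds] with y hy
  simp only [twist, hy.fderiv_eq]

theorem extDeriv_twist_congr {f₁ f₂ : E → ℂ} {z : E} (h : f₁ =ᶠ[nhds z] f₂) :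
    extDeriv (twist f₁) z = extDeriv (twist f₂) z := by
  apply Filter.EventuallyEq.extDeriv_eq
  filter_upwards [h.eventuallyEq_nhds] with y hy
  simp only [twist, hy.fderiv_eq]

theorem extDeriv_twist_add {f₁ f₂ : E → ℂ} {z : E} (h₁ : ContDiffAt ℝ 2 f₁ z)
    (h₂ : ContDiffAt ℝ 2 f₂ z) :
    extDeriv (twist fun y => f₁ y + f₂ y) z = extDeriv (twist f₁) z + extDeriv (twist f₂) z := by
  have h : twist (fun y => f₁ y + f₂ y) =ᶠ[nhds z] twist f₁ + twist f₂ := by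
    filter_upwards [h₁.eventually (by simp), h₂.eventually (by simp)] with y hy₁ hy₂
    ext v
    simp only [twist_apply, Pi.add_apply, ContinuousAlternatingMap.add_apply]
    rw [fderiv_fun_add (hy₁.differentiableAt two_ne_zero) (hy₂.differentiableAt two_ne_zero)]
    simp only [add_apply, smul_add]
  rw [h.extDeriv_eq, extDeriv_add
    ((contDiffAt_twist (m := 1) h₁ (by norm_num)).differentiableAt one_ne_zero)
    ((contDiffAt_twist (m := 1) h₂ (by norm_num)).differentiableAt one_ne_zero)]

end Potential

theorem wedge_dz_dzbar {ι : Type*} (a b : ι) (v : Fin 2 → ι → ℂ) :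
    wedge ![dz a, dzbar b] v =
      v 0 a * starRingEnd ℂ (v 1 b) - starRingEnd ℂ (v 0 b) * v 1 a := by
  change Matrix.det (Matrix.of fun l k => (![dz a, dzbar b] : Fin 2 → (ι → ℂ) →L[ℝ] ℂ) k (v l)) = _
  simp [Matrix.det_fin_two, dz, dzbar]

/-! ### `i∂∂̄` in coordinates -/

section Coordinates

variable {ι : Type*} [Fintype ι] [DecidableEq ι]

theorem eq_sum_single_re_im (v : ι → ℂ) :
    v = ∑ a, ((v a).re • (Pi.single a 1 : ι → ℂ) + (v a).im • (Pi.single a Complex.I : ι → ℂ)) := by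
  ext b
  simp only [Finset.sum_apply, Pi.add_apply, Pi.smul_apply, Pi.single_apply]
  rw [Finset.sum_eq_single b (fun a _ h => by simp [h.symm]) (by simp)]
  simp [Complex.re_add_im]

theorem del_delbar {f : (ι → ℂ) → ℂ} {z : ι → ℂ} (hf : ContDiffAt ℝ 2 f z) (a b : ι) :
    del a (delbar b f) z =
      (fderiv ℝ (fderiv ℝ f) z (Pi.single a 1) (Pi.single b 1)
        + Complex.I * fderiv ℝ (fderiv ℝ f) z (Pi.single a 1) (Pi.single b Complex.I)
        - Complex.I * fderiv ℝ (fderiv ℝ f) z (Pi.single a Complex.I) (Pi.single b 1)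
        + fderiv ℝ (fderiv ℝ f) z (Pi.single a Complex.I) (Pi.single b Complex.I)) / 4 := by
  have hd : DifferentiableAt ℝ (fderiv ℝ f) z :=
    (hf.fderiv_right (m := 1) (by norm_num)).differentiableAt one_ne_zero
  have hw : ∀ w, HasFDerivAt (fun y => fderiv ℝ f y w) ((fderiv ℝ (fderiv ℝ f) z).flip w) z := by
    intro w
    have := hd.hasFDerivAt.clm_apply (hasFDerivAt_const w z)
    simpa using this
  have h1 : HasFDerivAt (delbar b f) ((1 / 2 : ℂ) •
      ((fderiv ℝ (fderiv ℝ f) z).flip (Pi.single b 1)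
        + Complex.I • (fderiv ℝ (fderiv ℝ f) z).flip (Pi.single b Complex.I))) z := by
    have := ((hw (Pi.single b 1)).add ((hw (Pi.single b Complex.I)).const_mul Complex.I)).const_mul
      (1 / 2 : ℂ)
    refine this.congr_of_eventuallyEq (Filter.Eventually.of_forall fun y => ?_)
    simp only [delbar, Pi.add_apply]
    ring
  rw [del, h1.fderiv]
  simp only [smul_apply, add_apply,
    ContinuousLinearMap.flip_apply, smul_eq_mul]
  linear_combination (-(1 / 4) * fderiv ℝ (fderiv ℝ f) z (Pi.single a Complex.I)
    (Pi.single b Complex.I)) * Complex.I_mul_I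

/-- Both sides are expanded in the second derivatives of `f` along the real basis `e_a, i e_a` and
compared for each pair `(a, b)`. -/
theorem iddbar_eq_extDeriv {f : (ι → ℂ) → ℂ} {z : ι → ℂ} (hf : ContDiffAt ℝ 2 f z) :
    iddbar f z = extDeriv (twist f) z := by
  ext v
  have hs : IsSymmSndFDerivAt ℝ f z := hf.isSymmSndFDerivAt (by simp)
  rw [extDeriv_twist hf]
  simp only [iddbar, ContinuousAlternatingMap.smul_apply, ContinuousAlternatingMap.sum_apply,
    del_delbar hf, wedge_dz_dzbar, smul_eq_mul]
  set B := fderiv ℝ (fderiv ℝ f) z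
  have hB : ∀ u w : ι → ℂ, B u w = ∑ a, ∑ b,
      (((u a).re * (w b).re : ℝ) • B (Pi.single a 1) (Pi.single b 1)
        + ((u a).re * (w b).im : ℝ) • B (Pi.single a 1) (Pi.single b Complex.I)
        + ((u a).im * (w b).re : ℝ) • B (Pi.single a Complex.I) (Pi.single b 1)
        + ((u a).im * (w b).im : ℝ) • B (Pi.single a Complex.I) (Pi.single b Complex.I)) := by
    intro u w
    conv_lhs => rw [eq_sum_single_re_im u, eq_sum_single_re_im w]
    simp only [map_sum, map_add, map_smul, sum_apply,
      add_apply, smul_apply]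
    rw [Finset.sum_comm (f := fun a b => ((u a).re * (w b).re : ℝ) •
      B (Pi.single a 1) (Pi.single b 1) + _ + _ + _)]
    refine Finset.sum_congr rfl fun b _ => ?_
    rw [Finset.smul_sum, Finset.smul_sum, ← Finset.sum_add_distrib]
    refine Finset.sum_congr rfl fun a _ => ?_
    module
  rw [hB (Complex.I • v 0), hB (v 0)]
  -- Exchanging `a` and `b` in the second half leaves only the component `a` of `v 0` and the
  -- component `b` of `v 1`, so that the identity holds summand by summand.
  have h1 : ∀ G : ι → ι → ℂ, ∑ a, ∑ b, G a b *
      (v 0 a * starRingEnd ℂ (v 1 b) - starRingEnd ℂ (v 0 b) * v 1 a) =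
      ∑ a, ∑ b, (G a b * (v 0 a * starRingEnd ℂ (v 1 b))
        - G b a * (starRingEnd ℂ (v 0 a) * v 1 b)) := by
    intro G
    simp only [mul_sub, Finset.sum_sub_distrib]
    rw [Finset.sum_comm (f := fun a b => G a b * (starRingEnd ℂ (v 0 b) * v 1 a))]
  rw [h1, ← Finset.sum_sub_distrib, Finset.smul_sum, Finset.mul_sum]
  refine Finset.sum_congr rfl fun a _ => ?_
  rw [← Finset.sum_sub_distrib, Finset.smul_sum, Finset.mul_sum]
  refine Finset.sum_congr rfl fun b _ => ?_
  rw [hs.eq (Pi.single b 1) (Pi.single a 1), hs.eq (Pi.single b Complex.I) (Pi.single a Complex.I),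
    hs.eq (Pi.single b 1) (Pi.single a Complex.I), hs.eq (Pi.single b Complex.I) (Pi.single a 1)]
  change Complex.I * ((B _ _ + _ * B _ _ - _ * B _ _ + B _ _) / 4 * _ - _) = _
  generalize B (Pi.single a 1) (Pi.single b 1) = P
  generalize B (Pi.single a 1) (Pi.single b Complex.I) = Q
  generalize B (Pi.single a Complex.I) (Pi.single b 1) = Q'
  generalize B (Pi.single a Complex.I) (Pi.single b Complex.I) = R
  have hI : Complex.I ^ 2 = -1 := Complex.I_sq
  generalize hx : v 0 a = x
  generalize hy : v 1 b = y
  have h2 : (Complex.I • v 0) a = Complex.I * x := by rw [← hx]; rfl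
  have h3 : (Complex.I • v 1) b = Complex.I * y := by rw [← hy]; rfl
  rw [h2, h3]
  have hx1 : x = x.re + x.im * Complex.I := (Complex.re_add_im x).symm
  have hy1 : y = y.re + y.im * Complex.I := (Complex.re_add_im y).symm
  have hx2 : starRingEnd ℂ x = x.re - x.im * Complex.I := by
    apply Complex.ext <;> simp
  have hy2 : starRingEnd ℂ y = y.re - y.im * Complex.I := by
    apply Complex.ext <;> simp
  rw [hx2, hy2]
  simp only [Complex.real_smul, Complex.mul_re, Complex.mul_im, Complex.I_re, Complex.I_im,
    zero_mul, one_mul, zero_sub, zero_add]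
  push_cast
  generalize (x.re : ℂ) = a₁ at *
  generalize (x.im : ℂ) = a₂ at *
  generalize (y.re : ℂ) = b₁ at *
  generalize (y.im : ℂ) = b₂ at *
  rw [hx1, hy1]
  generalize Complex.I = i at *
  clear * - hI
  grind

end Coordinates

/-! ### The hermitian form of `i∂∂̄f` and the standard volume form -/

section Hermitian

open scoped ComplexOrder

variable {ι : Type*} [Fintype ι] [DecidableEq ι]

/-- The matrix `∂²f/∂z_a∂z̄_b`. -/
def levi (f : (ι → ℂ) → ℂ) (z : ι → ℂ) : Matrix ι ι ℂ :=
  Matrix.of fun a b => del a (delbar b f) z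

theorem iddbar_apply (f : (ι → ℂ) → ℂ) (z : ι → ℂ) (v w : ι → ℂ) :
    iddbar f z ![v, w] = Complex.I *
      (v ⬝ᵥ levi f z *ᵥ star w - w ⬝ᵥ levi f z *ᵥ star v) := by
  have h : ∀ u w : ι → ℂ, u ⬝ᵥ levi f z *ᵥ star w =
      ∑ a, ∑ b, del a (delbar b f) z * (u a * starRingEnd ℂ (w b)) := by
    intro u w
    simp only [dotProduct, Matrix.mulVec, Finset.mul_sum, levi, Matrix.of_apply, Pi.star_apply,
      ← starRingEnd_apply]
    exact Finset.sum_congr rfl fun a _ => Finset.sum_congr rfl fun b _ => by ring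
  simp only [iddbar, ContinuousAlternatingMap.smul_apply, ContinuousAlternatingMap.sum_apply,
    wedge_dz_dzbar, smul_eq_mul, h, ← Finset.sum_sub_distrib]
  congr 1
  refine Finset.sum_congr rfl fun a _ => Finset.sum_congr rfl fun b _ => ?_
  simp only [Matrix.cons_val_zero, Matrix.cons_val_one]
  ring

/-- With `h` the sesquilinear form of the Levi matrix, `θ(v, iw) = h(v,w) + h(w,v)` and `-i θ(v,w) =
h(v,w) - h(w,v)`. -/
theorem herm_iddbar (f : (ι → ℂ) → ℂ) (z : ι → ℂ) (v w : ι → ℂ) :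
    herm (iddbar f z) v w = v ⬝ᵥ levi f z *ᵥ star w := by
  rw [herm, iddbar_apply, iddbar_apply, star_smul, Matrix.mulVec_smul, dotProduct_smul,
    smul_dotProduct]
  simp only [smul_eq_mul, Complex.star_def, Complex.conj_I]
  linear_combination (-(v ⬝ᵥ levi f z *ᵥ star w)) * Complex.I_mul_I

theorem herm_iddbar_matrix (f : (ι → ℂ) → ℂ) (z : ι → ℂ) (e : ι → ι → ℂ) :
    (Matrix.of fun a b => herm (iddbar f z) (e a) (e b)) =
      Matrix.of e * levi f z * (Matrix.of e)ᴴ := by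
  ext a b
  rw [Matrix.of_apply, herm_iddbar, Matrix.mul_assoc, Matrix.mul_apply]
  rfl

theorem herm_iddbar_single (f : (ι → ℂ) → ℂ) (z : ι → ℂ) :
    (Matrix.of fun a b => herm (iddbar f z) (Pi.single a 1) (Pi.single b 1)) = levi f z := by
  rw [herm_iddbar_matrix]
  have : Matrix.of (fun a : ι => (Pi.single a 1 : ι → ℂ)) = 1 := by
    ext a b; simp [Matrix.one_apply, Pi.single_apply, eq_comm]
  rw [this]; simp

theorem det_herm_iddbar (f : (ι → ℂ) → ℂ) (z : ι → ℂ) (e : ι → ι → ℂ) :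
    (Matrix.of fun a b => herm (iddbar f z) (e a) (e b)).det =
      Complex.normSq (Matrix.of e).det * (levi f z).det := by
  rw [herm_iddbar_matrix, Matrix.det_mul, Matrix.det_mul, Matrix.det_conjTranspose,
    ← Complex.mul_conj, starRingEnd_apply]
  ring

theorem iddbar_im {f : (ι → ℂ) → ℂ} {z : ι → ℂ} (h : (levi f z).IsHermitian)
    (v w : ι → ℂ) : (iddbar f z ![v, w]).im = 0 := by
  have h1 : w ⬝ᵥ levi f z *ᵥ star v = starRingEnd ℂ (v ⬝ᵥ levi f z *ᵥ star w) := by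
    rw [starRingEnd_apply, ← Matrix.star_dotProduct_star, Matrix.star_mulVec, star_star, h.eq,
      ← Matrix.dotProduct_mulVec]
  rw [iddbar_apply, h1]
  simp

theorem iddbar_I_smul (f : (ι → ℂ) → ℂ) (z v w : ι → ℂ) :
    iddbar f z ![Complex.I • v, Complex.I • w] = iddbar f z ![v, w] := by
  simp only [iddbar_apply, star_smul, Matrix.mulVec_smul, dotProduct_smul,
    smul_dotProduct, smul_eq_mul, Complex.star_def, Complex.conj_I]
  linear_combination (-Complex.I * (v ⬝ᵥ levi f z *ᵥ star w - w ⬝ᵥ levi f z *ᵥ star v)) *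
    Complex.I_mul_I

theorem iddbar_pos {f : (ι → ℂ) → ℂ} {z : ι → ℂ} (h : (levi f z).PosDef) {v : ι → ℂ}
    (hv : v ≠ 0) : 0 < (iddbar f z ![v, Complex.I • v]).re := by
  have h1 : iddbar f z ![v, Complex.I • v] = 2 * (v ⬝ᵥ levi f z *ᵥ star v) := by
    rw [iddbar_apply, star_smul, Matrix.mulVec_smul, dotProduct_smul, smul_dotProduct]
    simp only [smul_eq_mul, Complex.star_def, Complex.conj_I]
    linear_combination (-2 * (v ⬝ᵥ levi f z *ᵥ star v)) * Complex.I_mul_I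
  have h2 : 0 < star (star v) ⬝ᵥ levi f z *ᵥ star v :=
    h.dotProduct_mulVec_pos (by simpa using hv)
  rw [star_star] at h2
  rw [h1]
  have := (Complex.lt_def.1 h2).1
  simpa using this

/-- Composition with `L` multiplies the matrix of values of the `dz` and `dz̄` by a block diagonal
matrix with blocks `E` and `Ē`, whose determinant is `|det E|²`. This is the factor found in
`det_herm_iddbar`. -/
theorem stdVol_comp (L : (ι → ℂ) →L[ℂ] (ι → ℂ)) :
    (stdVol ι).compContinuousLinearMap (L.restrictScalars ℝ) =
      Complex.normSq (Matrix.of fun a => L (Pi.single a 1)).det • stdVol ι := by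
  ext v
  set E : Matrix ι ι ℂ := Matrix.of fun a => L (Pi.single a 1) with hE
  have hL : ∀ (u : ι → ℂ) b, L u b = ∑ c, u c * E c b := by
    intro u b
    conv_lhs => rw [pi_eq_sum_univ' u]
    simp [map_sum, hE]
  have hM : (Matrix.of fun (l k : ι × Fin 2) =>
      (if k.2 = 0 then dz k.1 else dzbar k.1 : (ι → ℂ) →L[ℝ] ℂ) (L (v l))) =
      (Matrix.of fun (l k : ι × Fin 2) =>
        (if k.2 = 0 then dz k.1 else dzbar k.1 : (ι → ℂ) →L[ℝ] ℂ) (v l)) *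
      Matrix.blockDiagonal ![E, E.map (starRingEnd ℂ)] := by
    ext l ⟨b, t⟩
    rw [Matrix.mul_apply, Fintype.sum_prod_type]
    fin_cases t <;> simp [Matrix.blockDiagonal_apply, dz, dzbar, hL]
  change _ * Matrix.det (Matrix.of fun (l k : ι × Fin 2) =>
    (if k.2 = 0 then dz k.1 else dzbar k.1 : (ι → ℂ) →L[ℝ] ℂ) (L (v l))) =
    (Complex.normSq E.det : ℝ) • (_ * Matrix.det (Matrix.of fun (l k : ι × Fin 2) =>
      (if k.2 = 0 then dz k.1 else dzbar k.1 : (ι → ℂ) →L[ℝ] ℂ) (v l)))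
  rw [hM, Matrix.det_mul, Matrix.det_blockDiagonal]
  have : (E.map (starRingEnd ℂ)).det = starRingEnd ℂ E.det := (RingHom.map_det _ _).symm
  simp only [Fin.prod_univ_two, Matrix.cons_val_zero, Matrix.cons_val_one, this, Complex.mul_conj,
    Complex.real_smul]
  ring

theorem stdVol_single :
    stdVol ι (fun c => if c.2 = 0 then Pi.single c.1 1 else Complex.I • Pi.single c.1 1) = 1 := by
  change (Complex.I / 2) ^ Fintype.card ι * Matrix.det (Matrix.of fun (l k : ι × Fin 2) =>
    (if k.2 = 0 then dz k.1 else dzbar k.1 : (ι → ℂ) →L[ℝ] ℂ)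
      (if l.2 = 0 then Pi.single l.1 1 else Complex.I • Pi.single l.1 1)) = 1
  -- Each coordinate contributes a block with rows `(1, 1)` and `(i, -i)`, of determinant `-2i`,
  -- which cancels one factor `i/2`.
  have : (Matrix.of fun (l k : ι × Fin 2) =>
    (if k.2 = 0 then dz k.1 else dzbar k.1 : (ι → ℂ) →L[ℝ] ℂ)
      (if l.2 = 0 then Pi.single l.1 1 else Complex.I • Pi.single l.1 1)) =
      Matrix.kroneckerMap (· * ·) (1 : Matrix ι ι ℂ) !![1, 1; Complex.I, -Complex.I] := by
    ext ⟨a, s⟩ ⟨b, t⟩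
    by_cases hab : a = b
    · subst hab
      fin_cases s <;> fin_cases t <;> simp [dz, dzbar]
    · fin_cases s <;> fin_cases t <;> simp [dz, dzbar, hab, Ne.symm hab]
  rw [this, Matrix.det_kronecker, Matrix.det_one, one_pow, one_mul, ← mul_pow,
    Matrix.det_fin_two_of]
  have : Complex.I / 2 * (1 * -Complex.I - 1 * Complex.I) = 1 := by
    linear_combination (-1 : ℂ) * Complex.I_mul_I
  rw [this, one_pow]

theorem stdVol_frame (e : ι → ι → ℂ) :
    stdVol ι (fun c => if c.2 = 0 then e c.1 else Complex.I • e c.1) =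
      Complex.normSq (Matrix.of e).det := by
  let L : (ι → ℂ) →L[ℂ] (ι → ℂ) := LinearMap.toContinuousLinearMap (Fintype.linearCombination ℂ e)
  have hL : ∀ a, L (Pi.single a 1) = e a := fun a => by
    simp [L, Fintype.linearCombination_apply_single]
  have h := DFunLike.congr_fun (stdVol_comp L)
    (fun c => if c.2 = 0 then Pi.single c.1 1 else Complex.I • Pi.single c.1 1)
  simp only [hL, ContinuousAlternatingMap.compContinuousLinearMap_apply,
    ContinuousAlternatingMap.smul_apply, stdVol_single] at h
  rw [Complex.real_smul, mul_one] at h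
  rw [← h]
  congr 1
  funext c
  by_cases hc : c.2 = 0 <;> simp [hc, hL]

end Hermitian

/-! ### The Kähler potential -/

section Potential

open scoped ComplexOrder

variable {m n : Type*} [Fintype m] [Fintype n] [DecidableEq n]

/-- The function `log det (ᵗP P̄)`. -/
def logGram (Q : m × n → ℂ) : ℂ := (Real.log (gram (mat Q)).re : ℂ)

theorem gram_mul (P : Matrix m n ℂ) (A : Matrix n n ℂ) :
    gram (P * A) = gram P * Complex.normSq A.det := by
  rw [gram, gram, Matrix.transpose_mul, Matrix.map_mul, Matrix.mul_assoc,
    ← Matrix.mul_assoc Pᵀ, Matrix.det_mul, Matrix.det_mul, Matrix.det_transpose,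
    ← Complex.mul_conj, RingHom.map_det, RingHom.mapMatrix_apply]
  ring

theorem gram_eq_det_conjTranspose_mul (P : Matrix m n ℂ) : gram P = (Pᴴ * P).det := by
  rw [← Matrix.det_transpose, Matrix.transpose_mul, gram]
  rfl

/-- Full column rank makes `P` injective, so `Pᴴ P` is positive definite. The order on `ℂ` makes the
inequality include reality of `gram P`. -/
theorem gram_pos {P : Matrix m n ℂ} (hP : P.rank = Fintype.card n) : 0 < gram P := by
  rw [gram_eq_det_conjTranspose_mul]
  refine (Matrix.PosDef.conjTranspose_mul_self P ?_).det_pos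
  rw [← Matrix.coe_mulVecLin, ← LinearMap.ker_eq_bot, ← Submodule.finrank_eq_zero]
  have := P.mulVecLin.finrank_range_add_finrank_ker
  rw [Matrix.rank] at hP
  simp only [Module.finrank_fintype_fun_eq_card] at this
  omega

theorem contDiff_gram : ContDiff ℝ ω (fun Q : m × n → ℂ => gram (mat Q)) := by
  have h : ∀ i j, ContDiff ℝ ω fun Q : m × n → ℂ =>
      ((mat Q)ᵀ * (mat Q).map (starRingEnd ℂ)) i j := by
    intro i j
    simp only [Matrix.mul_apply, Matrix.transpose_apply, Matrix.map_apply, mat, Matrix.of_apply]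
    refine ContDiff.sum fun k _ => ContDiff.mul (contDiff_apply ℝ ℂ _) ?_
    exact Complex.conjCLE.contDiff.comp (contDiff_apply ℝ ℂ (k, j))
  simp only [gram, Matrix.det_apply, zsmul_eq_mul, Units.smul_def]
  exact ContDiff.sum fun σ _ => contDiff_const.mul (contDiff_prod fun i _ => h _ _)

theorem contDiffAt_logGram {Q : m × n → ℂ} (hQ : (mat Q).rank = Fintype.card n) :
    ContDiffAt ℝ ω logGram Q := by
  have h0 : (gram (mat Q)).re ≠ 0 := (Complex.lt_def.1 (gram_pos hQ)).1.ne'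
  have h1 : ContDiffAt ℝ ω (fun Q : m × n → ℂ => (gram (mat Q)).re) Q :=
    Complex.reCLM.contDiff.contDiffAt.comp Q contDiff_gram.contDiffAt
  exact Complex.ofRealCLM.contDiff.contDiffAt.comp Q (h1.log h0)

end Potential

/-! ### The potential in a chart and its Levi matrix -/

section Chart

open scoped ComplexOrder

variable {p q : ℕ}

/-- The matrix `1 + ᵗZ Z̄`. -/
def chartMat (Z : Model p q) : Matrix (Fin p) (Fin p) ℂ :=
  1 + (mat Z)ᵀ * (mat Z).map (starRingEnd ℂ)

/-- The Kähler potential `log det (1 + ᵗZ Z̄)`. -/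
def potential (Z : Model p q) : ℂ := (Real.log (chartGram Z).re : ℂ)

theorem chartMat_posDef (Z : Model p q) : (chartMat Z).PosDef :=
  Matrix.PosDef.one.add_posSemidef
    (by simpa [Matrix.conjTranspose, Matrix.map_map, Function.comp_def, Matrix.transpose_map] using
      Matrix.posSemidef_conjTranspose_mul_self ((mat Z).map (starRingEnd ℂ)))

theorem chartGram_pos (Z : Model p q) : 0 < chartGram Z := (chartMat_posDef Z).det_pos

theorem chartMat_det_ne_zero (Z : Model p q) : (chartMat Z).det ≠ 0 := (chartGram_pos Z).ne'

theorem gram_frame (I : Idx p q) (Z : Model p q) : gram (frame I Z) = chartGram Z := by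
  rw [gram, chartGram]
  congr 1
  ext i j
  rw [Matrix.mul_apply, ← I.equiv.sum_comp, Fintype.sum_sum_type]
  have h : ∑ x, (1 : Matrix (Fin p) (Fin p) ℂ) x i *
      starRingEnd ℂ ((1 : Matrix (Fin p) (Fin p) ℂ) x j) = (1 : Matrix (Fin p) (Fin p) ℂ) i j := by
    rw [Finset.sum_eq_single i (fun b _ hb => by rw [Matrix.one_apply_ne hb, zero_mul]) (by simp)]
    rw [Matrix.one_apply_eq, one_mul, Matrix.one_apply]
    split_ifs <;> simp
  simp [frame, Matrix.mul_apply, h]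

theorem potential_eq_logGram (I : Idx p q) (Z : Model p q) :
    potential Z = logGram (entries (frame I Z)) := by
  rw [potential, logGram, mat_entries, gram_frame]

theorem contDiff_entries_frame (I : Idx p q) :
    ContDiff ℂ ω fun Z : Model p q => entries (frame I Z) :=
  contDiff_pi.2 fun _ => contDiff_frame I _ _

theorem contDiff_potential : ContDiff ℝ ω (potential : Model p q → ℂ) := by
  obtain ⟨I⟩ := nonempty_idx (p := p) (q := q)
  rw [funext (potential_eq_logGram I), contDiff_iff_contDiffAt]
  intro Z
  refine ContDiffAt.comp (g := logGram) Z (contDiffAt_logGram ?_)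
    ((contDiff_entries_frame I).restrict_scalars ℝ).contDiffAt
  rw [mat_entries, rank_frame, Fintype.card_fin]

/-- The determinant is real and positive. The complex logarithm lets Jacobi's formula apply without
taking real parts. -/
theorem potential_eq_log (Z : Model p q) : potential Z = Complex.log (chartMat Z).det := by
  have h := Complex.lt_def.1 (chartGram_pos Z)
  rw [potential, Complex.ofReal_log h.1.le]
  congr 1
  exact Complex.ext rfl h.2

/-- The derivative of `1 + ᵗZ Z̄` in the direction `W`. -/
def chartMatDeriv (Z W : Model p q) : Matrix (Fin p) (Fin p) ℂ :=
  (mat W)ᵀ * (mat Z).map (starRingEnd ℂ) + (mat Z)ᵀ * (mat W).map (starRingEnd ℂ)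

theorem hasDerivAt_line {ι : Type*} (Z W : ι → ℂ) (a : ι) (t : ℝ) :
    HasDerivAt (fun s : ℝ => (Z + s • W) a) (W a) t := by
  have := ((hasDerivAt_id t).ofReal_comp.mul_const (W a)).const_add (Z a)
  simpa using this

theorem hasDerivAt_chartMat (Z W : Model p q) (i j : Fin p) :
    HasDerivAt (fun t : ℝ => chartMat (Z + t • W) i j) (chartMatDeriv Z W i j) 0 := by
  have h : HasDerivAt (fun t : ℝ => (1 : Matrix (Fin p) (Fin p) ℂ) i j +
      ∑ k, (Z + t • W) (k, i) * starRingEnd ℂ ((Z + t • W) (k, j)))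
      (∑ k, (W (k, i) * starRingEnd ℂ ((Z + (0 : ℝ) • W) (k, j)) +
        (Z + (0 : ℝ) • W) (k, i) * starRingEnd ℂ (W (k, j)))) 0 := by
    refine (HasDerivAt.fun_sum fun k _ => ?_).const_add _
    exact (hasDerivAt_line Z W _ 0).mul
      (Complex.conjCLE.hasFDerivAt.comp_hasDerivAt 0 (hasDerivAt_line Z W _ 0))
  simpa [chartMat, chartMatDeriv, Matrix.mul_apply, mat, Finset.sum_add_distrib] using h

theorem fderiv_potential (Z W : Model p q) :
    fderiv ℝ potential Z W = ((chartMat Z)⁻¹ * chartMatDeriv Z W).trace := by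
  have h1 : HasDerivAt (fun t : ℝ => potential (Z + t • W)) (fderiv ℝ potential Z W) 0 :=
    (contDiff_potential.differentiable (by simp) Z).hasFDerivAt.hasLineDerivAt W
  have h0 : chartMat (Z + (0 : ℝ) • W) = chartMat Z := by simp
  have h2 := hasDerivAt_det (hasDerivAt_chartMat Z W)
  simp only [potential_eq_log] at h1
  have h3 := h2.clog_real (by
    left
    exact (Complex.lt_def.1 (chartGram_pos (Z + (0 : ℝ) • W))).1)
  rw [h1.unique h3, h0, Matrix.inv_def, Ring.inverse_eq_inv', Matrix.smul_mul, Matrix.trace_smul,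
    smul_eq_mul]
  ring

theorem mat_single (c : ℂ) (k : Fin q) (l : Fin p) :
    mat (Pi.single (k, l) c : Model p q) = Matrix.single k l c := by
  ext i j
  simp only [mat, Matrix.of_apply, Pi.single_apply, Matrix.single_apply, Prod.mk.injEq, eq_comm]

/-- In `tr((1 + ᵗZ Z̄)⁻¹ (ᵗW Z̄ + ᵗZ W̄))` the combination defining `∂/∂z̄` kills the part linear in
`W` and keeps the antilinear one. -/
theorem delbar_potential (Z : Model p q) (k : Fin q) (l : Fin p) :
    delbar (k, l) potential Z = ((chartMat Z)⁻¹ * (mat Z)ᵀ) l k := by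
  have h1 : ∀ c : ℂ, (Matrix.single k l c).map (starRingEnd ℂ) =
      starRingEnd ℂ c • Matrix.single k l (1 : ℂ) := by
    intro c; rw [Matrix.map_single, Matrix.smul_single, smul_eq_mul, mul_one]
  have h2 : ∀ c : ℂ, (Matrix.single k l c)ᵀ = c • Matrix.single l k (1 : ℂ) := by
    intro c; simp
  simp only [delbar, fderiv_potential, chartMatDeriv, mat_single, h1, h2, Matrix.mul_add,
    Matrix.trace_add, Matrix.mul_smul, Matrix.smul_mul, Matrix.trace_smul, ← Matrix.mul_assoc]
  have h3 : ((chartMat Z)⁻¹ * (mat Z)ᵀ * Matrix.single k l (1 : ℂ)).trace =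
      ((chartMat Z)⁻¹ * (mat Z)ᵀ) l k := by
    rw [Matrix.trace_mul_single]; simp
  rw [h3]
  simp only [smul_eq_mul, Complex.conj_I, map_one]
  linear_combination (1 / 2 * ((chartMat Z)⁻¹ * Matrix.single l k (1 : ℂ) *
    (mat Z).map (starRingEnd ℂ)).trace - 1 / 2 * ((chartMat Z)⁻¹ * (mat Z)ᵀ) l k) * Complex.I_mul_I

/-- The matrix `1 - Z̄ (1 + ᵗZ Z̄)⁻¹ ᵗZ` is the inverse of `1 + Z̄ ᵗZ`. -/
theorem inv_one_add_mul_transpose (Z : Model p q) :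
    (1 + (mat Z).map (starRingEnd ℂ) * (mat Z)ᵀ)⁻¹ =
      1 - (mat Z).map (starRingEnd ℂ) * (chartMat Z)⁻¹ * (mat Z)ᵀ := by
  apply Matrix.inv_eq_right_inv
  have h : chartMat Z * (chartMat Z)⁻¹ = 1 :=
    Matrix.mul_nonsing_inv _ (isUnit_iff_ne_zero.2 (chartMat_det_ne_zero Z))
  have h2 : (mat Z).map (starRingEnd ℂ) * (chartMat Z * (chartMat Z)⁻¹) * (mat Z)ᵀ =
      (mat Z).map (starRingEnd ℂ) * (mat Z)ᵀ := by rw [h, Matrix.mul_one]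
  rw [chartMat] at h2 ⊢
  generalize (1 + (mat Z)ᵀ * (mat Z).map (starRingEnd ℂ))⁻¹ = S at *
  simp only [Matrix.mul_add, Matrix.add_mul, Matrix.one_mul, Matrix.mul_sub, Matrix.mul_one,
    Matrix.mul_assoc] at h2 ⊢
  rw [← h2]
  abel

/-- With `S = (1 + ᵗZ Z̄)⁻¹`, the part of the derivative of `S ᵗZ` that is complex-linear in `W` is
`S ᵗW (1 - Z̄ S ᵗZ) = S ᵗW (1 + Z̄ ᵗZ)⁻¹`. For a matrix unit `W` its entries are products of one
entry of each factor. -/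
theorem levi_potential (Z : Model p q) :
    levi potential Z = Matrix.kroneckerMap (· * ·)
      (1 + (mat Z).map (starRingEnd ℂ) * (mat Z)ᵀ)⁻¹ ((chartMat Z)⁻¹)ᵀ := by
  ext ⟨i, j⟩ ⟨k, l⟩
  have hd : DifferentiableAt ℝ (delbar (k, l) potential) Z := by
    have h1 : ContDiff ℝ 1 (fderiv ℝ (potential : Model p q → ℂ)) :=
      contDiff_potential.fderiv_right (by simp)
    have h2 : Differentiable ℝ (fderiv ℝ (potential : Model p q → ℂ)) :=
      h1.differentiable one_ne_zero
    unfold delbar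
    fun_prop
  have hdir : ∀ W : Model p q, fderiv ℝ (delbar (k, l) potential) Z W =
      ((chartMat Z)⁻¹ * (mat W)ᵀ - (chartMat Z)⁻¹ * chartMatDeriv Z W * (chartMat Z)⁻¹ *
        (mat Z)ᵀ) l k := by
    intro W
    have h1 : HasDerivAt (fun t : ℝ => delbar (k, l) potential (Z + t • W)) _ 0 :=
      hd.hasFDerivAt.hasLineDerivAt W
    simp only [delbar_potential] at h1
    have h0 : chartMat (Z + (0 : ℝ) • W) = chartMat Z := by simp
    have h2 : ∀ b, HasDerivAt (fun t : ℝ => (chartMat (Z + t • W))⁻¹ l b)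
        ((-((chartMat Z)⁻¹ * chartMatDeriv Z W * (chartMat Z)⁻¹)) l b) 0 := by
      intro b
      have := hasDerivAt_inv_entry (hasDerivAt_chartMat Z W) (chartMat_det_ne_zero _) l b
      rwa [h0] at this
    have h3 : HasDerivAt (fun t : ℝ => ((chartMat (Z + t • W))⁻¹ * (mat (Z + t • W))ᵀ) l k)
        (∑ b, ((-((chartMat Z)⁻¹ * chartMatDeriv Z W * (chartMat Z)⁻¹)) l b *
          (Z + (0 : ℝ) • W) (k, b) + (chartMat (Z + (0 : ℝ) • W))⁻¹ l b * W (k, b))) 0 := by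
      simp only [Matrix.mul_apply (M := (chartMat (_ + _))⁻¹)]
      exact HasDerivAt.fun_sum fun b _ => (h2 b).mul (hasDerivAt_line Z W (k, b) 0)
    rw [h1.unique h3, h0, zero_smul, add_zero, Finset.sum_add_distrib, Matrix.sub_apply,
      sub_eq_neg_add, Matrix.mul_apply (N := (mat Z)ᵀ), Matrix.mul_apply (N := (mat W)ᵀ),
      ← Finset.sum_neg_distrib]
    simp [mat]
  have h1 : ∀ c : ℂ, (Matrix.single i j c).map (starRingEnd ℂ) =
      starRingEnd ℂ c • Matrix.single i j (1 : ℂ) := by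
    intro c; rw [Matrix.map_single, Matrix.smul_single, smul_eq_mul, mul_one]
  have h2 : ∀ c : ℂ, (Matrix.single i j c)ᵀ = c • Matrix.single j i (1 : ℂ) := by
    intro c; simp
  have h3 : ((chartMat Z)⁻¹ * Matrix.single j i (1 : ℂ) *
      ((1 : Matrix (Fin q) (Fin q) ℂ) -
        (mat Z).map (starRingEnd ℂ) * (chartMat Z)⁻¹ * (mat Z)ᵀ)) l k =
      (chartMat Z)⁻¹ l j * ((1 : Matrix (Fin q) (Fin q) ℂ) -
        (mat Z).map (starRingEnd ℂ) * (chartMat Z)⁻¹ * (mat Z)ᵀ) i k := by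
    rw [Matrix.mul_assoc, Matrix.mul_apply, Finset.sum_eq_single j]
    · rw [Matrix.single_mul_apply_same, one_mul]
    · intro b _ hb
      rw [Matrix.single_mul_apply_of_ne _ _ _ _ _ hb, mul_zero]
    · simp
  rw [Matrix.kroneckerMap_apply, Matrix.transpose_apply, inv_one_add_mul_transpose, mul_comm, ← h3]
  simp only [levi, Matrix.of_apply, del, hdir, chartMatDeriv, mat_single, h1, h2,
    Matrix.mul_add, Matrix.add_mul, Matrix.mul_smul, Matrix.smul_mul, Matrix.sub_apply,
    Matrix.add_apply, Matrix.smul_apply, Matrix.mul_sub, Matrix.mul_one, Matrix.mul_assoc,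
    smul_eq_mul, map_one, Complex.conj_I]
  -- The terms `x` and `y` are linear in the direction and survive in `∂/∂z`; `w` comes from the
  -- variation of `Z̄` and cancels.
  generalize ((chartMat Z)⁻¹ * Matrix.single j i (1 : ℂ)) l k = x
  generalize ((chartMat Z)⁻¹ * (Matrix.single j i (1 : ℂ) *
    ((mat Z).map (starRingEnd ℂ) * ((chartMat Z)⁻¹ * (mat Z)ᵀ)))) l k = y
  generalize ((chartMat Z)⁻¹ * ((mat Z)ᵀ * (Matrix.single i j (1 : ℂ) *
    ((chartMat Z)⁻¹ * (mat Z)ᵀ)))) l k = w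
  linear_combination (-1 / 2 * (x - y + w)) * Complex.I_mul_I

theorem levi_potential_posDef (Z : Model p q) : (levi potential Z).PosDef := by
  rw [levi_potential]
  refine Matrix.PosDef.kronecker (Matrix.PosDef.inv ?_) (Matrix.PosDef.transpose
    (chartMat_posDef Z).inv)
  refine Matrix.PosDef.one.add_posSemidef ?_
  simpa [Matrix.conjTranspose, Matrix.map_map, Function.comp_def, Matrix.transpose_map] using
      Matrix.posSemidef_self_mul_conjTranspose ((mat Z).map (starRingEnd ℂ))

/-- In the determinant of the Kronecker product the `q × q` factor enters to the power `p` and the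
`p × p` factor to the power `q`; `det (1 + AB) = det (1 + BA)` equates their determinants. -/
theorem det_levi_potential (Z : Model p q) :
    (levi potential Z).det = chartGram Z ^ (-((p : ℤ) + q)) := by
  have h : (1 + (mat Z).map (starRingEnd ℂ) * (mat Z)ᵀ).det = chartGram Z := by
    rw [Matrix.det_one_add_mul_comm]; rfl
  have h' : (chartMat Z).det = chartGram Z := rfl
  rw [levi_potential, Matrix.det_kronecker, Matrix.det_transpose, Matrix.det_nonsing_inv,
    Matrix.det_nonsing_inv, h, h', Ring.inverse_eq_inv', Fintype.card_fin, Fintype.card_fin,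
    ← pow_add, zpow_neg, inv_pow, ← Nat.cast_add, zpow_natCast]

end Chart

/-! ### Derivatives of maps into the Grassmann manifold -/

section Manifold

variable {p q : ℕ}

/-- The index of the preferred chart at a point. -/
def idx (x : Gr p q) : Idx p q := (exists_param x).choose

/-- The coordinates of a point in its preferred chart. -/
def crd (x : Gr p q) : Model p q := (exists_param x).choose_spec.choose

theorem param_crd (x : Gr p q) : param (idx x) (crd x) = x :=
  (exists_param x).choose_spec.choose_spec

theorem extChartAt_param {x : Gr p q} {J : Idx p q} (hJ : idx x = J) (Z : Model p q) :
    extChartAt 𝓘(ℂ, Model p q) x (param J Z) = Z := by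
  subst hJ
  exact chart_param (idx x) Z

theorem continuous_param (I : Idx p q) : Continuous (param I) := by
  have h := ((core p q).openPartialHomeomorph (chart I) ⟨I, rfl⟩).continuousOn_symm
  have ht : ((core p q).openPartialHomeomorph (chart I) ⟨I, rfl⟩).target = Set.univ :=
    chart_target I
  rw [ht] at h
  exact continuousOn_univ.1 h

variable {E : Type*} [NormedAddCommGroup E] [NormedSpace ℂ E]

/-- The tangent space at `F z` is the model space read in the preferred chart there. As `J` is
required to index that chart, no Jacobian of a change of charts appears. -/
theorem hasMFDerivAt_of_eventuallyEq_param {F : E → Gr p q} {φ : E → Model p q} {z : E}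
    {J : Idx p q} (hJ : idx (F z) = J) (hφ : DifferentiableAt ℂ φ z)
    (h : ∀ᶠ w in nhds z, F w = param J (φ w)) :
    HasMFDerivAt 𝓘(ℂ, E) 𝓘(ℂ, Model p q) F z (fderiv ℂ φ z) := by
  refine ⟨?_, ?_⟩
  · have h1 : ContinuousAt (fun w => param J (φ w)) z :=
      (continuous_param J).continuousAt.comp hφ.continuousAt
    exact h1.congr (h.mono fun _ hw => hw.symm)
  · simp only [mfld_simps]
    refine HasFDerivAt.hasFDerivWithinAt (x := z) ?_
    refine hφ.hasFDerivAt.congr_of_eventuallyEq ?_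
    filter_upwards [h] with w hw
    change extChartAt 𝓘(ℂ, Model p q) (F z) (F w) = φ w
    rw [hw]
    exact extChartAt_param hJ (φ w)

/-- In the preferred chart at `x` the parametrization has the identity as its derivative at the
coordinates of `x`, so the chart expression there is `θ x` itself. -/
theorem form_ext {κ : Type} {θ θ' : Form p q κ} (h : ∀ I Z, inChart I θ Z = inChart I θ' Z) :
    θ = θ' := by
  have key : ∀ x : Gr p q, θ (param (idx x) (crd x)) = θ' (param (idx x) (crd x)) := by
    intro x
    have hd : HasMFDerivAt 𝓘(ℂ, Model p q) 𝓘(ℂ, Model p q) (param (idx x)) (crd x)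
        (ContinuousLinearMap.id ℂ (Model p q)) := by
      rw [← fderiv_id (𝕜 := ℂ) (x := crd x)]
      exact hasMFDerivAt_of_eventuallyEq_param (by rw [param_crd]) differentiableAt_id
        (Filter.Eventually.of_forall fun _ => rfl)
    have h1 := h (idx x) (crd x)
    simp only [inChart, pullback, hd.mfderiv] at h1
    ext v
    exact DFunLike.congr_fun h1 v
  funext x
  have := key x
  rwa [param_crd] at this

/-- The chart coordinates of the column space of a matrix. -/
def projCoord (J : Idx p q) (Q : Fin (p + q) × Fin p → ℂ) : Model p q :=
  entries (minorCompl J (mat Q) * (minor J (mat Q))⁻¹)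

theorem contDiffAt_minor_det (J : Idx p q) (Q : Fin (p + q) × Fin p → ℂ) :
    ContDiffAt ℂ ω (fun Q : Fin (p + q) × Fin p → ℂ => (minor J (mat Q)).det) Q :=
  (contDiffOn_det (s := Set.univ) fun _ _ => (contDiff_apply ℂ ℂ _).contDiffOn).contDiffAt
    Filter.univ_mem

theorem contDiffAt_projCoord {J : Idx p q} {Q : Fin (p + q) × Fin p → ℂ}
    (hQ : (minor J (mat Q)).det ≠ 0) : ContDiffAt ℂ ω (projCoord J) Q := by
  rw [contDiffAt_pi]
  rintro ⟨i, j⟩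
  have hm : ∀ a b, ContDiff ℂ ω fun Q : Fin (p + q) × Fin p → ℂ => minor J (mat Q) a b :=
    fun a b => contDiff_apply ℂ ℂ _
  simp only [projCoord, entries, Matrix.mul_apply, Matrix.inv_def, Matrix.smul_apply, smul_eq_mul,
    Ring.inverse_eq_inv']
  refine ContDiffAt.sum fun k _ => ?_
  have h1 : ContDiffAt ℂ ω (fun Q : Fin (p + q) × Fin p → ℂ => minorCompl J (mat Q) i k) Q :=
    (contDiff_apply ℂ ℂ _).contDiffAt
  refine h1.mul (ContDiffAt.mul ((contDiffAt_minor_det J Q).inv hQ) ?_)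
  simp only [Matrix.adjugate_apply]
  refine (contDiffOn_det (s := Set.univ) fun a b => ?_).contDiffAt Filter.univ_mem
  by_cases h : a = j
  · subst h; simp only [Matrix.updateRow_self]; exact contDiffOn_const
  · simp only [Matrix.updateRow_ne h]; exact (hm a b).contDiffOn

theorem proj_eq {Q : Fin (p + q) × Fin p → ℂ} (hQ : (mat Q).rank = p) :
    proj Q = ⟨LinearMap.range (mat Q).mulVecLin, hQ⟩ :=
  dif_pos hQ

theorem proj_eq_param {J : Idx p q} {Q : Fin (p + q) × Fin p → ℂ}
    (hQ : (minor J (mat Q)).det ≠ 0) : proj Q = param J (projCoord J Q) := by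
  rw [proj_eq (rank_of_minor J hQ)]
  exact Subtype.ext ((range_eq_iff J _ (mat Q)).2 ⟨hQ, rfl⟩).symm

theorem minor_ne_zero_of_proj_eq {J : Idx p q} {Q : Fin (p + q) × Fin p → ℂ} {Z : Model p q}
    (hQ : (mat Q).rank = p) (h : proj Q = param J Z) : (minor J (mat Q)).det ≠ 0 := by
  rw [proj_eq hQ] at h
  exact ((range_eq_iff J Z (mat Q)).1 (Subtype.ext_iff.1 h).symm).1

theorem proj_frame (I : Idx p q) (Z : Model p q) : proj (entries (frame I Z)) = param I Z := by
  have hr : (mat (entries (frame I Z))).rank = p := by rw [mat_entries, rank_frame]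
  rw [proj_eq hr]
  rfl

theorem eventually_minor_ne_zero {J : Idx p q} {Q : Fin (p + q) × Fin p → ℂ}
    (hQ : (minor J (mat Q)).det ≠ 0) : ∀ᶠ P in nhds Q, (minor J (mat P)).det ≠ 0 :=
  (contDiffAt_minor_det J Q).continuousAt.eventually_ne hQ

theorem hasMFDerivAt_proj {J : Idx p q} {Q : Fin (p + q) × Fin p → ℂ} (hJ : idx (proj Q) = J)
    (hQ : (minor J (mat Q)).det ≠ 0) :
    HasMFDerivAt 𝓘(ℂ, Fin (p + q) × Fin p → ℂ) 𝓘(ℂ, Model p q) proj Q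
      (fderiv ℂ (projCoord J) Q) :=
  hasMFDerivAt_of_eventuallyEq_param hJ ((contDiffAt_projCoord hQ).differentiableAt (by simp))
    ((eventually_minor_ne_zero hQ).mono fun _ hP => proj_eq_param hP)

theorem minor_idx_ne_zero {Q : Fin (p + q) × Fin p → ℂ} (hQ : (mat Q).rank = p) :
    (minor (idx (proj Q)) (mat Q)).det ≠ 0 :=
  minor_ne_zero_of_proj_eq hQ (param_crd (proj Q)).symm

theorem crd_proj {Q : Fin (p + q) × Fin p → ℂ} (hQ : (mat Q).rank = p) :
    crd (proj Q) = projCoord (idx (proj Q)) Q := by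
  apply param_injective (idx (proj Q))
  rw [param_crd, ← proj_eq_param (minor_idx_ne_zero hQ)]

/-- This is the chain rule for `π ∘ P_I = φ_I⁻¹`; it shows that `π^*θ` on the matrices of rank `p`
determines `θ`. -/
theorem inChart_eq_pullback_proj {κ : Type} (I : Idx p q) (θ : Form p q κ) (Z : Model p q) :
    inChart I θ Z = (pullback proj θ (entries (frame I Z))).compContinuousLinearMap
      ((fderiv ℂ (fun Y : Model p q => entries (frame I Y)) Z).restrictScalars ℝ) := by
  have hr : (mat (entries (frame I Z))).rank = p := by rw [mat_entries, rank_frame]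
  have hF : HasFDerivAt (fun Y : Model p q => entries (frame I Y)) _ Z :=
    ((contDiff_entries_frame I).differentiable (by simp) Z).hasFDerivAt
  have h2 := hasMFDerivAt_proj rfl (minor_idx_ne_zero hr)
  have h1 := h2.comp Z hF.hasMFDerivAt
  have h3 : proj ∘ (fun Y : Model p q => entries (frame I Y)) = param I :=
    funext fun Y => proj_frame I Y
  have h4 : inChart I θ = pullback (proj ∘ fun Y : Model p q => entries (frame I Y)) θ := by
    rw [inChart, h3]
  rw [h4]
  simp only [pullback, h1.mfderiv, h2.mfderiv]
  rfl

end Manifold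

/-! ### The metric and its volume form -/

section Metric

open scoped ComplexOrder

variable {p q : ℕ}

theorem logGram_eq_add {J : Idx p q} {Q : Fin (p + q) × Fin p → ℂ}
    (hQ : (minor J (mat Q)).det ≠ 0) : logGram Q =
      potential (projCoord J Q) + (Real.log (Complex.normSq (minor J (mat Q)).det) : ℂ) := by
  have hu : IsUnit (minor J (mat Q)).det := isUnit_iff_ne_zero.2 hQ
  have h1 : mat Q = frame J (projCoord J Q) * minor J (mat Q) := by
    apply ext_rows J
    · rw [minor_mul, minor_frame, Matrix.one_mul]
    · rw [minorCompl_mul, minorCompl_frame, projCoord, mat_entries, Matrix.mul_assoc,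
        Matrix.nonsing_inv_mul _ hu, Matrix.mul_one]
  have h2 : gram (mat Q) = chartGram (projCoord J Q) * Complex.normSq (minor J (mat Q)).det := by
    conv_lhs => rw [h1]
    rw [gram_mul, gram_frame]
  rw [logGram, h2, Complex.re_mul_ofReal, Real.log_mul
    (Complex.lt_def.1 (chartGram_pos _)).1.ne' (Complex.normSq_pos.2 hQ).ne', Complex.ofReal_add]
  rfl

/-- In `logGram_eq_add` the term `log |det m_J|²` is pluriharmonic, and the other is the potential
composed with a holomorphic map. -/
theorem iddbar_logGram {J : Idx p q} {Q : Fin (p + q) × Fin p → ℂ}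
    (hQ : (minor J (mat Q)).det ≠ 0) : iddbar logGram Q =
      (iddbar potential (projCoord J Q)).compContinuousLinearMap
        ((fderiv ℂ (projCoord J) Q).restrictScalars ℝ) := by
  have hr : (mat Q).rank = Fintype.card (Fin p) := by rw [rank_of_minor J hQ, Fintype.card_fin]
  have hpot : ContDiffAt ℝ 2 potential (projCoord J Q) := contDiff_potential.contDiffAt.of_le le_top
  have hco : ContDiffAt ℂ 2 (projCoord J) Q := (contDiffAt_projCoord hQ).of_le le_top
  have hdet : ContDiffAt ℂ 2 (fun Q : Fin (p + q) × Fin p → ℂ => (minor J (mat Q)).det) Q :=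
    (contDiffAt_minor_det J Q).of_le le_top
  have hsq : ContDiffAt ℝ 2 (fun Q : Fin (p + q) × Fin p → ℂ =>
      (Real.log (Complex.normSq (minor J (mat Q)).det) : ℂ)) Q := by
    have h1 : ContDiffAt ℝ 2 (fun Q : Fin (p + q) × Fin p → ℂ =>
        ‖(minor J (mat Q)).det‖ ^ 2) Q := (hdet.restrict_scalars ℝ).norm_sq ℝ
    have h2 := h1.log (by simpa using hQ)
    simp only [← Complex.normSq_eq_norm_sq] at h2
    exact Complex.ofRealCLM.contDiff.contDiffAt.comp Q h2
  rw [iddbar_eq_extDeriv ((contDiffAt_logGram hr).of_le le_top), iddbar_eq_extDeriv hpot,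
    ← extDeriv_twist_comp hpot hco,
    extDeriv_twist_congr ((eventually_minor_ne_zero hQ).mono fun _ hP => logGram_eq_add hP),
    extDeriv_twist_add (f₁ := fun P => potential (projCoord J P))
      (hpot.comp Q (hco.restrict_scalars ℝ)) hsq,
    extDeriv_twist_log_normSq hdet hQ, add_zero]
  rfl

/-- The Kähler metric form `i∂∂̄ log det (1 + ᵗZ Z̄)` of the Grassmann manifold. -/
def metric (p q : ℕ) : Form p q (Fin 2) := fun x => iddbar potential (crd x)

/-- The form `det (1 + ᵗZ Z̄)^{-(p+q)} (i/2)^{pq} ⋀ (dz_a ∧ dz̄_a)`. -/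
def etaForm (p q : ℕ) : Form p q ((Fin q × Fin p) × Fin 2) := fun x =>
  ‖chartGram (crd x)‖ ^ (-((p : ℤ) + q)) • stdVol (Fin q × Fin p)

theorem isGrassmannMetric_metric : IsGrassmannMetric (metric p q) := by
  intro P hP
  have h := hasMFDerivAt_proj rfl (minor_idx_ne_zero hP)
  rw [pullback, h.mfderiv]
  change (iddbar potential (crd (proj P))).compContinuousLinearMap _ = iddbar logGram P
  rw [iddbar_logGram (minor_idx_ne_zero hP), crd_proj hP]
  rfl

theorem isGrassmannMetric_iff (θ : Form p q (Fin 2)) : IsGrassmannMetric θ ↔ θ = metric p q := by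
  constructor
  · intro h
    refine form_ext fun I Z => ?_
    have hr : (mat (entries (frame I Z))).rank = p := by rw [mat_entries, rank_frame]
    rw [inChart_eq_pullback_proj, inChart_eq_pullback_proj, h _ hr, isGrassmannMetric_metric _ hr]
  · rintro rfl
    exact isGrassmannMetric_metric

/-- `metric` is defined through preferred charts only. Pulling `π^*` of it back along the
holomorphic frame `P_I` gives the same formula in every chart, with no computation of transition
maps. -/
theorem inChart_metric (I : Idx p q) (Z : Model p q) :
    inChart I (metric p q) Z = iddbar potential Z := by
  have hr : (mat (entries (frame I Z))).rank = p := by rw [mat_entries, rank_frame]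
  have hlog : ContDiffAt ℝ 2 logGram (entries (frame I Z)) :=
    (contDiffAt_logGram (by rw [hr, Fintype.card_fin])).of_le le_top
  rw [inChart_eq_pullback_proj, isGrassmannMetric_metric _ hr,
    iddbar_eq_extDeriv (contDiff_potential.contDiffAt.of_le le_top)]
  change (iddbar logGram _).compContinuousLinearMap _ = _
  have hF : ContDiffAt ℂ 2 (fun Y : Model p q => entries (frame I Y)) Z :=
    (contDiff_entries_frame I).contDiffAt.of_le le_top
  rw [iddbar_eq_extDeriv hlog]
  refine (extDeriv_twist_comp (F := fun Y : Model p q => entries (frame I Y)) hlog hF).symm.trans ?_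
  rw [funext (potential_eq_logGram I)]
  rfl

/-! ### Volume form, Kähler property and Ricci form -/

theorem coeff_metric (I : Idx p q) (Z : Model p q) :
    coeff I (metric p q) Z = levi potential Z := by
  rw [coeff, inChart_metric, herm_iddbar_single]

theorem norm_chartGram (Z : Model p q) : (‖chartGram Z‖ : ℂ) = chartGram Z :=
  Complex.norm_of_nonneg' (chartGram_pos Z).le

/-- Let `L` be the derivative of `φ_I⁻¹` read in the preferred chart. The chart formula for the
metric forces the Levi determinants, which are the densities of `η`, to differ by `|det L|²`,
exactly the factor by which `L` scales `stdVol`. -/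
theorem inChart_etaForm (I : Idx p q) (Z : Model p q) : inChart I (etaForm p q) Z =
    ‖chartGram Z‖ ^ (-((p : ℤ) + q)) • stdVol (Fin q × Fin p) := by
  let L : Model p q →L[ℂ] Model p q := mfderiv 𝓘(ℂ, Model p q) 𝓘(ℂ, Model p q) (param I) Z
  have h1 : (iddbar potential (crd (param I Z))).compContinuousLinearMap (L.restrictScalars ℝ) =
      iddbar potential Z := inChart_metric I Z
  have h2 : (levi potential Z).det = Complex.normSq (Matrix.of fun a => L (Pi.single a 1)).det *
      (levi potential (crd (param I Z))).det := by
    rw [← det_herm_iddbar, ← herm_iddbar_single, ← h1]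
    congr 1
    ext a b
    simp only [Matrix.of_apply, herm, ContinuousAlternatingMap.compContinuousLinearMap_apply]
    have h3 : ∀ v w : Model p q, ⇑(L.restrictScalars ℝ) ∘ ![v, w] = ![L v, L w] := by
      intro v w; ext i; fin_cases i <;> rfl
    rw [h3, h3, map_smul]
  rw [det_levi_potential, det_levi_potential, ← norm_chartGram, ← norm_chartGram (crd _)] at h2
  have h4 : ‖chartGram Z‖ ^ (-((p : ℤ) + q)) =
      Complex.normSq (Matrix.of fun a => L (Pi.single a 1)).det *
        ‖chartGram (crd (param I Z))‖ ^ (-((p : ℤ) + q)) := by exact_mod_cast h2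
  change (‖chartGram (crd (param I Z))‖ ^ (-((p : ℤ) + q)) •
    stdVol (Fin q × Fin p)).compContinuousLinearMap (L.restrictScalars ℝ) = _
  rw [h4, mul_comm, mul_smul, ← stdVol_comp]
  rfl

theorem isEta_iff (μ : Form p q ((Fin q × Fin p) × Fin 2)) : IsEta μ ↔ μ = etaForm p q := by
  constructor
  · intro h
    exact form_ext fun I Z => (h I Z).trans (inChart_etaForm I Z).symm
  · rintro rfl
    exact inChart_etaForm

/-- A unitary basis with coordinate matrix `e` satisfies `1 = |det e|² det (g_{ab})`, and the right
side is the value of `η` on `(e_a, i e_a)`. -/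
theorem isVolumeForm_etaForm : IsVolumeForm (metric p q) (etaForm p q) := by
  intro x e h
  have h1 := det_herm_iddbar potential (crd x) e
  have h2 : (Matrix.of fun a b => herm (iddbar potential (crd x)) (e a) (e b)) = 1 := by
    ext a b
    rw [Matrix.of_apply, Matrix.one_apply]
    exact h a b
  rw [h2, Matrix.det_one, det_levi_potential, ← norm_chartGram] at h1
  change ‖chartGram (crd x)‖ ^ (-((p : ℤ) + q)) • stdVol (Fin q × Fin p)
    (fun c => if c.2 = 0 then e c.1 else Complex.I • e c.1) = 1
  have h3 := stdVol_frame (ι := Fin q × Fin p) e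
  refine (congrArg _ h3).trans ?_
  rw [h1, Complex.real_smul]
  push_cast
  ring

theorem contDiff_iddbar_potential : ContDiff ℝ ∞ (iddbar (potential : Model p q → ℂ)) := by
  have h : ∀ f : Model p q → ℂ, ContDiff ℝ ∞ f → ∀ v, ContDiff ℝ ∞ fun z => fderiv ℝ f z v :=
    fun f hf v => (hf.fderiv_right (by simp)).clm_apply contDiff_const
  have hdb : ∀ b, ContDiff ℝ ∞ (delbar b (potential : Model p q → ℂ)) := fun b =>
    have hp := h _ (contDiff_potential.of_le le_top)
    ((hp _).add (contDiff_const.mul (hp _))).div_const 2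
  have hd : ∀ a b, ContDiff ℝ ∞ (del a (delbar b (potential : Model p q → ℂ))) := fun a b =>
    ((h _ (hdb b) _).sub (contDiff_const.mul (h _ (hdb b) _))).div_const 2
  unfold iddbar
  exact (ContDiff.sum fun a _ => ContDiff.sum fun b _ => (hd a b).smul contDiff_const).const_smul _

theorem isKahler_metric : IsKahler (metric p q) where
  smooth I := by
    rw [funext (inChart_metric I)]
    exact contDiff_iddbar_potential
  real x v := by
    have hv : v = ![v 0, v 1] := by ext i; fin_cases i <;> rfl
    rw [hv]
    exact iddbar_im (levi_potential_posDef _).isHermitian _ _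
  type x v w := iddbar_I_smul _ _ _ _
  pos x v hv := iddbar_pos (levi_potential_posDef _) hv
  -- In each chart the metric is exact, with primitive `twist potential`.
  closed I Z := by
    have h : inChart I (metric p q) = extDeriv (twist potential) := funext fun Y => by
      rw [inChart_metric, iddbar_eq_extDeriv (contDiff_potential.contDiffAt.of_le le_top)]
    rw [h]
    exact extDeriv_extDeriv_apply (r := 2)
      (contDiffAt_twist (n := ω) contDiff_potential.contDiffAt le_top) (by simp)

theorem iddbar_const_smul {ι : Type*} [Fintype ι] [DecidableEq ι] (c : ℝ) {f : (ι → ℂ) → ℂ}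
    {z : ι → ℂ} (hf : ContDiff ℝ 2 f) :
    iddbar (fun y => c • f y) z = c • iddbar f z := by
  have h : twist (fun y => c • f y) = c • twist f := by
    funext y
    ext v
    rw [Pi.smul_apply, ContinuousAlternatingMap.smul_apply, twist_apply, twist_apply,
      fderiv_fun_const_smul (hf.differentiable two_ne_zero y), smul_apply,
      smul_comm]
  rw [iddbar_eq_extDeriv hf.contDiffAt, iddbar_eq_extDeriv (hf.const_smul c).contDiffAt, h,
    extDeriv_smul]

/-- The logarithm of `det (g_{ab})` is `-(p+q)` times the potential, and `i∂∂̄` of the potential is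
the metric. -/
theorem isRicciForm_metric :
    IsRicciForm (metric p q) (fun x => ((p : ℝ) + q) • metric p q x) := by
  intro I Z
  have h1 : (fun Y : Model p q => (Real.log ((coeff I (metric p q) Y).det).re : ℂ)) =
      fun Y => (-((p : ℝ) + q)) • potential Y := by
    funext Y
    have h2 : ((levi potential Y).det).re = ‖chartGram Y‖ ^ (-((p : ℤ) + q)) := by
      rw [det_levi_potential, ← norm_chartGram, ← Complex.ofReal_zpow, Complex.ofReal_re,
        norm_chartGram]
    have h3 : (chartGram Y).re = ‖chartGram Y‖ := by
      rw [← norm_chartGram, Complex.ofReal_re, norm_chartGram]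
    rw [coeff_metric, h2, Real.log_zpow, potential, h3, Complex.real_smul]
    push_cast
    ring
  rw [h1, iddbar_const_smul _ (contDiff_potential.of_le le_top), ← inChart_metric I Z]
  ext v
  change ((p : ℝ) + q) • inChart I (metric p q) Z v =
    -((-((p : ℝ) + q)) • inChart I (metric p q) Z v)
  rw [neg_smul, neg_neg]

end Metric

end Grassmann

end

theorem mainTheorem2 (p q : ℕ) :
    ∃ (g : Grassmann.Form p q (Fin 2)) (η : Grassmann.Form p q ((Fin q × Fin p) × Fin 2)),
      (∀ θ, Grassmann.IsGrassmannMetric θ ↔ θ = g) ∧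
      (∀ μ, Grassmann.IsEta μ ↔ μ = η) ∧
      Grassmann.IsVolumeForm g η ∧
      (∀ (I : Grassmann.Idx p q) (Z : Grassmann.Model p q),
        (Grassmann.coeff I g Z).det = Grassmann.chartGram Z ^ (-((p : ℤ) + q))) ∧
      Grassmann.IsRicciForm g (fun x => ((p : ℝ) + q) • g x) ∧
      Grassmann.IsKahlerEinstein g ((p : ℝ) + q) :=
  ⟨Grassmann.metric p q, Grassmann.etaForm p q, Grassmann.isGrassmannMetric_iff,
    Grassmann.isEta_iff, Grassmann.isVolumeForm_etaForm,
    fun I Z => by rw [Grassmann.coeff_metric, Grassmann.det_levi_potential],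
    Grassmann.isRicciForm_metric, Grassmann.isKahler_metric, Grassmann.isRicciForm_metric⟩
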